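/- All matroids are finite. For a matroid $M$ on $S$, let $r_M$ be its rank function and $\eta_M(X)=|X|-r_M(X)$; a cyclic flat is a flat that is a (possibly empty) union of circuits; $\mathcal{Z}'(M)$ is the set of nonempty proper cyclic flats; and $FI(M)$ is the set of elements of $M$ that are in no proper cyclic flat of $M$. An intertwine of $M_1$ and $M_2$ is a matroid that has minors isomorphic to $M_1$ and to $M_2$ but no proper minor of which has both. The free extension of $M$ by a new element $x\notin S$ has as circuits those of $M$ and the sets $B\cup\{x\}$ with $B$ a basis of $M$; free coextension is the dual operation. **The construction.** Let $M_1$, $M_2$ be matroids of positive rank on disjoint sets $S_1$, $S_2$, with rank functions $r_1,r_2$ and nullities $\eta_1,\eta_2$. Given $S'_1\subseteq S_1$, $S'_2\subseteq S_2$, an integer $k\ge r(M_1)+\eta_1(S'_1)+r(M_2)+\eta_2(S'_2)$, and sets $T_1$, $T_2$ with $|T_1|=k-r(M_1)-|S'_2|$, $|T_2|=k-r(M_2)-|S'_1|$ and $T_1$, $T_2$, $S_1\cup S_2$ mutually disjoint, let $M$ be the matroid on $S_1\cup S_2\cup T_1\cup T_2$ whose cyclic flats are the sets $F\cup T_1\cup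 S'_2$ with $F\in\mathcal{Z}'(M_1)$, of rank $r_1(F)+|T_1|+|S'_2|$; the sets $F\cup T_2\cup S'_1$ with $F\in\mathcal{Z}'(M_2)$, of rank $r_2(F)+|T_2|+|S'_1|$; $\emptyset$, of rank $0$; and $S_1\cup S_2\cup T_1\cup T_2$, of rank $k$. **Corollary.** Suppose that no matroid isomorphic to $M_1$ (resp. $M_2$) can be obtained from $M_2$ (resp. $M_1$) by any combination of minors, free extensions and free coextensions, and that $FI(M_i)=\emptyset=FI(M_i^*)$ for $i\in\{1,2\}$. Let $k\ge 4\max\{|S_1|,|S_2|\}$ be an integer. Then for every admissible choice of $S'_1,S'_2,T_1,T_2$ the matroid $M$ exists, is unique, and is a rank-$k$ intertwine of $M_1$ and $M_2$. The matroids so constructed for this $k$ fall into at least $(|S_1|+1)(|S_2|+1)$ isomorphism classes. If, in addition, both $M_1$ and $M_2$ have trivial automorphism groups, then they fall into exactly $2^{|S_1|+|S_2|}$ isomorphism classes. -/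

import Mathlib

namespace Matroid

universe u

variable {α : Type u}

/-! ### Isomorphism -/

/-- A bijection between the ground sets is an isomorphism of matroids if a set is independent
exactly when its image is. -/
def IsIsomorphism (M N : Matroid α) (e : M.E ≃ N.E) : Prop :=
  ∀ I : Set M.E, M.Indep (Subtype.val '' I) ↔ N.Indep (Subtype.val '' (e '' I))

/-- `M` and `N` are isomorphic. -/
def Isomorphic (M N : Matroid α) : Prop := ∃ e : M.E ≃ N.E, M.IsIsomorphism N e

/-- The identity is the only automorphism of `M`. -/
def HasTrivialAut (M : Matroid α) : Prop :=
  ∀ e : M.E ≃ M.E, M.IsIsomorphism M e → e = Equiv.refl M.E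

theorem isomorphic_equivalence : Equivalence (Isomorphic (α := α)) where
  refl M := ⟨Equiv.refl _, fun I ↦ by simp⟩
  symm := by
    rintro M N ⟨e, he⟩
    refine ⟨e.symm, fun I ↦ ?_⟩
    rw [he (e.symm '' I), Equiv.image_symm_image]
  trans := by
    rintro M N P ⟨e, he⟩ ⟨f, hf⟩
    refine ⟨e.trans f, fun I ↦ ?_⟩
    rw [he I, hf (e '' I), Set.image_image f e I]
    rfl

/-- Isomorphism, as an equivalence relation on the matroids with elements in `α`. -/
def isoSetoid (α : Type u) : Setoid (Matroid α) := ⟨Isomorphic, isomorphic_equivalence⟩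

/-- The set of isomorphism classes of the members of a collection of matroids. -/
def isoClasses (𝒞 : Set (Matroid α)) : Set (Quotient (isoSetoid α)) :=
  Quotient.mk (isoSetoid α) '' 𝒞

/-! ### Intertwines -/

/-- `M` has a minor isomorphic to `N`. -/
def HasMinorIso (M N : Matroid α) : Prop := ∃ N', N' ≤m M ∧ N'.Isomorphic N

/-- `M`, but none of its proper minors, has both an `M₁`-minor and an `M₂`-minor. -/
def IsIntertwine (M M₁ M₂ : Matroid α) : Prop :=
  (M.HasMinorIso M₁ ∧ M.HasMinorIso M₂) ∧
    ∀ N, N <m M → ¬ (N.HasMinorIso M₁ ∧ N.HasMinorIso M₂)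

/-! ### Free extensions and free coextensions -/

/-- `N` is the free extension of `M` by the new element `x`: its circuits are those of `M`
together with the sets `B ∪ {x}`, where `B` is a base of `M`. -/
def IsFreeExtension (M : Matroid α) (x : α) (N : Matroid α) : Prop :=
  x ∉ M.E ∧ N.E = insert x M.E ∧
    ∀ C, N.IsCircuit C ↔ M.IsCircuit C ∨ ∃ B, M.IsBase B ∧ C = insert x B

/-- `N` is the free coextension of `M` by the new element `x`. -/
def IsFreeCoextension (M : Matroid α) (x : α) (N : Matroid α) : Prop :=
  IsFreeExtension M✶ x N✶

/-- The matroids that can be obtained from `M` by any combination of minors, free extensions and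
free coextensions. -/
inductive Obtainable (M : Matroid α) : Matroid α → Prop
  | refl : Obtainable M M
  | minor {N N' : Matroid α} : Obtainable M N → N' ≤m N → Obtainable M N'
  | freeExtension {N N' : Matroid α} {x : α} :
      Obtainable M N → IsFreeExtension N x N' → Obtainable M N'
  | freeCoextension {N N' : Matroid α} {x : α} :
      Obtainable M N → IsFreeCoextension N x N' → Obtainable M N'

/-! ### Cyclic flats -/

/-- A cyclic set is a (possibly empty) union of circuits. -/
def IsCyclicSet (M : Matroid α) (X : Set α) : Prop :=
  ∃ 𝒞 : Set (Set α), (∀ C ∈ 𝒞, M.IsCircuit C) ∧ X = ⋃₀ 𝒞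

/-- Cyclic flats. -/
def IsCyclicFlat (M : Matroid α) (F : Set α) : Prop := M.IsFlat F ∧ M.IsCyclicSet F

/-- Nonempty proper cyclic flats. -/
def IsNonemptyProperCyclicFlat (M : Matroid α) (F : Set α) : Prop :=
  M.IsCyclicFlat F ∧ F.Nonempty ∧ F ≠ M.E

/-- The elements of `M` that are in no proper cyclic flat of `M`
(the free elements and the isthmuses). -/
def freeOrIsthmus (M : Matroid α) : Set α :=
  {x ∈ M.E | ∀ F, M.IsCyclicFlat F → F ≠ M.E → x ∉ F}

/-! ### The construction -/

/-- Admissible data for the construction from `M₁`, `M₂`: the inequality on `k` reads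
`k ≥ r(M₁) + η₁(S₁') + r(M₂) + η₂(S₂')`, with `ηᵢ(X) = |X| - rᵢ(X)`, and the sizes of `T₁`, `T₂`
are `k - r(M₁) - |S₂'|` and `k - r(M₂) - |S₁'|`; all subtractions are moved to the other side. -/
structure AmalgamData (M₁ M₂ : Matroid α) (k : ℕ) (S₁' S₂' T₁ T₂ : Set α) : Prop where
  subset₁ : S₁' ⊆ M₁.E
  subset₂ : S₂' ⊆ M₂.E
  le_k : M₁.eRank + S₁'.encard + M₂.eRank + S₂'.encard ≤ k + M₁.eRk S₁' + M₂.eRk S₂'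
  card₁ : T₁.encard + M₁.eRank + S₂'.encard = k
  card₂ : T₂.encard + M₂.eRank + S₁'.encard = k
  disjoint_T : Disjoint T₁ T₂
  disjoint₁ : Disjoint T₁ (M₁.E ∪ M₂.E)
  disjoint₂ : Disjoint T₂ (M₁.E ∪ M₂.E)

/-- `M` is the matroid on `S₁ ∪ S₂ ∪ T₁ ∪ T₂` with the following cyclic flats and ranks: the sets
`F ∪ T₁ ∪ S₂'`, of rank `r₁(F) + |T₁| + |S₂'|`, and `F ∪ T₂ ∪ S₁'`, of rank
`r₂(F) + |T₂| + |S₁'|`, where `F` runs over the nonempty proper cyclic flats of `M₁` and `M₂`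
respectively; the empty set, of rank `0`; and the whole ground set, of rank `k`. -/
structure IsFreeAmalgam (M₁ M₂ : Matroid α) (k : ℕ) (S₁' S₂' T₁ T₂ : Set α) (M : Matroid α) :
    Prop where
  ground : M.E = M₁.E ∪ M₂.E ∪ T₁ ∪ T₂
  cyclicFlat_iff : ∀ Z, M.IsCyclicFlat Z ↔
    (∃ F, M₁.IsNonemptyProperCyclicFlat F ∧ Z = F ∪ T₁ ∪ S₂') ∨
    (∃ F, M₂.IsNonemptyProperCyclicFlat F ∧ Z = F ∪ T₂ ∪ S₁') ∨
    Z = ∅ ∨ Z = M₁.E ∪ M₂.E ∪ T₁ ∪ T₂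
  rank₁ : ∀ F, M₁.IsNonemptyProperCyclicFlat F →
    M.eRk (F ∪ T₁ ∪ S₂') = M₁.eRk F + T₁.encard + S₂'.encard
  rank₂ : ∀ F, M₂.IsNonemptyProperCyclicFlat F →
    M.eRk (F ∪ T₂ ∪ S₁') = M₂.eRk F + T₂.encard + S₁'.encard
  rank_empty : M.eRk ∅ = 0
  rank_ground : M.eRk (M₁.E ∪ M₂.E ∪ T₁ ∪ T₂) = k

/-- All matroids that the construction gives for the given `M₁`, `M₂` and `k`. -/
def constructed (M₁ M₂ : Matroid α) (k : ℕ) : Set (Matroid α) :=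
  {M | ∃ S₁' S₂' T₁ T₂, AmalgamData M₁ M₂ k S₁' S₂' T₁ T₂ ∧
    IsFreeAmalgam M₁ M₂ k S₁' S₂' T₁ T₂ M}

end Matroid

/-! Write `C₁ = T₁ ∪ S₂'`, `U₁ = T₂ ∪ (S₂ \ S₂')`, and symmetrically `C₂`, `U₂`. The function `rᵢ(A)
+ |Cᵢ| + |A ∩ Uᵢ|` (`liftRk`), cut off at `|A|` and at `k`, is the rank function of the matroid got
from `Mᵢ` by freely coextending by `Cᵢ` and then freely extending by `Uᵢ`
(`exists_obtainable_liftRk`). The constructed matroid has as rank function the minimum of `|A|`, `k`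
and both lifts (`glueRk`). Since `k` is large, the sum of one lift at `A` and the other at `B` is at
least `2k + |A ∩ B| - d`, with `d = |S₁| + |S₂|` (the field `gap` of `IsGluing`). So where one lift
is at most `|A|`, the other is at least `k`: the two never interfere. This gives submodularity
(`exists_isGlued`) and the prescribed cyclic flats (`isCyclicFlat_iff`). Conversely, cyclic flats
and their ranks determine a matroid, so the prescription forces `glueRk`
(`isGlued_of_isCyclicFlat_iff`). Existence and uniqueness follow (`isFreeAmalgam_iff`).

The heart of the matter is that an `M₁`-minor can sit in only one place: on `S₁`, with `C₁`
contracted (`eq_of_isMinorRep`). If the lift of `M₁` were inactive on all sets relevant to the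
minor, then `M₁` would be a minor of the lift of `M₂`, hence obtainable from `M₂`. Otherwise the gap
makes the lift of `M₂` inactive there. An element of `C₁` is a loop for the lift of `M₁` and an
element of `U₁` is a coloop, whereas the conditions on `FI` provide, for each element of `M₁`, sets
that witness that it is neither. Thus the minor lies on `S₁`, and comparing ranks yields the
contracted set (`image_eq`). A proper minor with both minors would require an element to be deleted
in both places or contracted in both places, but every element is in `S₁ ∪ S₂` or in exactly one
`Cᵢ` (`isIntertwine`).

For the count, the same rigidity shows that an isomorphism of constructed matroids maps each `Sᵢ` to
itself by an automorphism of `Mᵢ` and carries `Sᵢ'` to `Sᵢ'`. Hence `(|S₁'|, |S₂'|)` is an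
invariant, and with trivial automorphism groups `(S₁', S₂')` is a complete one. -/

namespace Matroid

open Finset

/-! ### Natural-number rank of finite sets, rank axioms, and cyclic flats in terms of rank -/

section Rank

variable {α : Type*} {M N : Matroid α} {A B E : Finset α} {e : α}

/-- The rank of a finite set, as a natural number. -/
noncomputable def rk (M : Matroid α) (A : Finset α) : ℕ := (M.eRk (A : Set α)).toNat

lemma coe_rk (M : Matroid α) (A : Finset α) : (M.rk A : ℕ∞) = M.eRk (A : Set α) :=
  ENat.natCast_toNat (eRk_ne_top_iff.2 (M.isRkFinite_of_finite A.finite_toSet))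

lemma rk_eq_iff {n : ℕ} : M.rk A = n ↔ M.eRk (A : Set α) = n := by
  rw [← coe_rk, Nat.cast_inj]

lemma rk_eq_rk_iff : M.rk A = N.rk B ↔ M.eRk (A : Set α) = N.eRk (B : Set α) := by
  rw [← coe_rk, ← coe_rk, Nat.cast_inj]

@[simp] lemma rk_empty (M : Matroid α) : M.rk ∅ = 0 := by
  rw [rk_eq_iff]; simp

lemma rk_mono (M : Matroid α) (h : A ⊆ B) : M.rk A ≤ M.rk B := by
  rw [← Nat.cast_le (α := ℕ∞), coe_rk, coe_rk]
  exact M.eRk_mono (by exact_mod_cast h)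

lemma rk_le_card (M : Matroid α) (A : Finset α) : M.rk A ≤ #A := by
  rw [← Nat.cast_le (α := ℕ∞), coe_rk, ← Set.encard_coe_eq_coe_finsetCard]
  exact M.eRk_le_encard _

lemma indep_coe_iff : M.Indep (A : Set α) ↔ M.rk A = #A := by
  rw [indep_iff_eRk_eq_encard_of_finite A.finite_toSet, rk_eq_iff,
    Set.encard_coe_eq_coe_finsetCard]

lemma eRank_eq_rk (hE : M.E = E) : M.eRank = M.rk E := by
  rw [coe_rk, ← hE, eRk_ground]

/-- Two matroids on a finite ground set with the same rank function are equal. -/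
lemma ext_rk (hM : M.E = E) (hN : N.E = E) (h : ∀ A ⊆ E, M.rk A = N.rk A) : M = N := by
  refine ext_indep (hM.trans hN.symm) fun I hI ↦ ?_
  lift I to Finset α using (E.finite_toSet.subset (hI.trans hM.subset))
  rw [indep_coe_iff, indep_coe_iff, h I (by rw [hM] at hI; exact_mod_cast hI)]

lemma IsCyclicFlat.exists_finset {F : Set α} (hF : M.IsCyclicFlat F) (hE : M.E = E) :
    ∃ A ⊆ E, F = (A : Set α) := by
  have h : F ⊆ E := hE ▸ hF.1.subset_ground
  lift F to Finset α using E.finite_toSet.subset h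
  exact ⟨F, by exact_mod_cast h, rfl⟩

variable [DecidableEq α]

lemma rk_submod (M : Matroid α) (A B : Finset α) :
    M.rk (A ∩ B) + M.rk (A ∪ B) ≤ M.rk A + M.rk B := by
  rw [← Nat.cast_le (α := ℕ∞)]
  push_cast [coe_rk]
  exact M.eRk_inter_add_eRk_union_le _ _

lemma rk_union_le (M : Matroid α) (A B : Finset α) : M.rk (A ∪ B) ≤ M.rk A + M.rk B := by
  have := M.rk_submod A B
  omega

lemma rk_insert_le (M : Matroid α) (e : α) (A : Finset α) : M.rk (insert e A) ≤ M.rk A + 1 := by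
  have := M.rk_union_le A {e}
  have h := M.rk_le_card {e}
  rw [union_comm, ← insert_eq] at this
  simp only [card_singleton] at h
  omega

lemma rk_le_rk_erase (M : Matroid α) (e : α) (A : Finset α) : M.rk A ≤ M.rk (A.erase e) + 1 :=
  (M.rk_mono (by intro x; by_cases x = e <;> simp_all)).trans (M.rk_insert_le e _)

lemma rk_le_rk_add_card_sdiff (M : Matroid α) (A B : Finset α) : M.rk A ≤ M.rk B + #(A \ B) := by
  have h1 := M.rk_union_le B (A \ B)
  have h2 := M.rk_le_card (A \ B)
  have h3 : M.rk A ≤ M.rk (B ∪ A \ B) := M.rk_mono (by intro x; simp; tauto)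
  omega

lemma rk_inter_ground (hE : M.E = E) (A : Finset α) : M.rk (A ∩ E) = M.rk A := by
  rw [rk_eq_rk_iff, coe_inter, ← hE, eRk_inter_ground]

lemma rk_le_rk_ground (hE : M.E = E) (A : Finset α) : M.rk A ≤ M.rk E := by
  rw [← rk_inter_ground hE]
  exact M.rk_mono inter_subset_right

lemma rk_insert_of_notMem (hE : M.E = E) (he : e ∉ E) (A : Finset α) :
    M.rk (insert e A) = M.rk A := by
  rw [← rk_inter_ground hE, insert_inter_of_notMem he, rk_inter_ground hE]

lemma rk_erase_of_notMem (hE : M.E = E) (he : e ∉ E) (A : Finset α) :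
    M.rk (A.erase e) = M.rk A := by
  rw [← rk_inter_ground hE, ← rk_inter_ground hE A, erase_inter, erase_eq_of_notMem]
  simp [he]

/-- If the elements of `D` do not raise the rank of `A` one by one, then `D` does not. -/
lemma rankFn_union_eq {f : Finset α → ℕ} (hmono : ∀ A B, A ⊆ B → B ⊆ E → f A ≤ f B)
    (hsub : ∀ A B, A ⊆ E → B ⊆ E → f (A ∩ B) + f (A ∪ B) ≤ f A + f B)
    {D : Finset α} (hA : A ⊆ E) (hD : D ⊆ E) (h : ∀ e ∈ D, f (insert e A) ≤ f A) :
    f (A ∪ D) = f A := by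
  induction D using Finset.induction_on with
  | empty => simp
  | insert e D he ih =>
    have heE : e ∈ E := hD (mem_insert_self _ _)
    have hD' : D ⊆ E := (subset_insert _ _).trans hD
    have ih' := ih hD' fun x hx ↦ h x (mem_insert_of_mem hx)
    have h1 := hsub (A ∪ D) (insert e A) (union_subset hA hD')
      (insert_subset heE hA)
    have h2 := hmono A ((A ∪ D) ∩ insert e A)
      (subset_inter subset_union_left (subset_insert _ _))
      (inter_subset_left.trans (union_subset hA hD'))
    have h3 : (A ∪ D) ∪ insert e A = A ∪ insert e D := by ext x; simp; tauto
    have h4 := hmono A (A ∪ insert e D) subset_union_left (union_subset hA hD)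
    have h5 := h e (mem_insert_self _ _)
    rw [h3] at h1
    omega

/-- A function that satisfies the rank axioms is the rank function of a matroid. -/
theorem exists_matroid_of_rankFn (E : Finset α) (f : Finset α → ℕ)
    (hcard : ∀ A ⊆ E, f A ≤ #A) (hmono : ∀ A B, A ⊆ B → B ⊆ E → f A ≤ f B)
    (hsub : ∀ A B, A ⊆ E → B ⊆ E → f (A ∩ B) + f (A ∪ B) ≤ f A + f B) :
    ∃ M : Matroid α, M.E = E ∧ ∀ A ⊆ E, M.rk A = f A := by
  have hempty : f ∅ = 0 := by simpa using hcard ∅ (empty_subset _)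
  let M₀ : IndepMatroid α := IndepMatroid.ofFinset (E : Set α) (fun I ↦ I ⊆ E ∧ f I = #I)
    ⟨empty_subset _, by simpa using hempty⟩
    (by
      rintro I J ⟨hJ, hJf⟩ hIJ
      refine ⟨hIJ.trans hJ, (hcard _ (hIJ.trans hJ)).antisymm ?_⟩
      have h1 := hsub I (J \ I) (hIJ.trans hJ) (sdiff_subset.trans hJ)
      have h2 := hcard (J \ I) (sdiff_subset.trans hJ)
      have h3 := card_sdiff_add_card_eq_card hIJ
      rw [union_sdiff_of_subset hIJ] at h1
      omega)
    -- If no element of `J` augments `I`, then `f` is constant from `I` to `I ∪ J`, which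
    -- contradicts `f J = |J| > |I|`.
    (by
      rintro I J ⟨hI, hIf⟩ ⟨hJ, hJf⟩ hlt
      by_contra! hcon
      have h1 : f (I ∪ J) = f I := by
        refine rankFn_union_eq hmono hsub hI hJ fun e he ↦ ?_
        by_cases heI : e ∈ I
        · rw [insert_eq_of_mem heI]
        have h2 := hcon e he heI (insert_subset (hJ he) hI)
        have h3 := hcard (insert e I) (insert_subset (hJ he) hI)
        rw [card_insert_of_notMem heI] at h2 h3
        omega
      have h4 := hmono J (I ∪ J) subset_union_right (union_subset hI hJ)
      omega)
    (fun I hI ↦ by exact_mod_cast hI.1)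
  let M := M₀.matroid
  have hind : ∀ I : Finset α, M.Indep (I : Set α) ↔ I ⊆ E ∧ f I = #I := fun I ↦ by
    rw [IndepMatroid.matroid_indep_iff]
    exact IndepMatroid.ofFinset_indep ..
  refine ⟨M, rfl, fun A hA ↦ ?_⟩
  obtain ⟨I, hI⟩ := M.exists_isBasis (A : Set α) (by change (A : Set α) ⊆ (E : Set α); simpa)
  lift I to Finset α using A.finite_toSet.subset hI.subset
  have hIA : I ⊆ A := by exact_mod_cast hI.subset
  have hIf := (hind I).1 hI.indep
  rw [rk_eq_iff, hI.eRk_eq_encard, Set.encard_coe_eq_coe_finsetCard, Nat.cast_inj, ← hIf.2,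
    ← union_eq_right.2 hIA]
  refine (rankFn_union_eq hmono hsub hIf.1 hA fun e he ↦ ?_).symm
  by_cases heI : e ∈ I
  · rw [insert_eq_of_mem heI]
  have h2 : ¬ M.Indep (insert e (I : Set α)) := fun h ↦
    heI (by exact_mod_cast hI.mem_of_insert_indep (by exact_mod_cast he) h)
  rw [← coe_insert, hind] at h2
  have h3 := hcard (insert e I) (insert_subset (hA he) hIf.1)
  have h4 : f (insert e I) ≠ #(insert e I) := fun h ↦ h2 ⟨insert_subset (hA he) hIf.1, h⟩
  rw [card_insert_of_notMem heI] at h3 h4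
  omega

/-! ### Cyclic flats and rank -/

lemma mem_closure_iff_rk (he : e ∈ M.E) :
    e ∈ M.closure (A : Set α) ↔ M.rk (insert e A) ≤ M.rk A := by
  refine ⟨fun h ↦ ?_, fun h ↦ by_contra fun hcl ↦ ?_⟩
  · rw [← Nat.cast_le (α := ℕ∞), coe_rk, coe_rk, coe_insert, ← eRk_insert_closure_eq,
      Set.insert_eq_of_mem h, eRk_closure_eq]
  · have h1 : M.rk (insert e A) = M.rk A + 1 := by
      rw [rk_eq_iff, coe_insert, eRk_insert_eq_add_one ⟨he, hcl⟩]
      simp [coe_rk]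
    omega

lemma isFlat_coe_iff (hE : M.E = E) (hA : A ⊆ E) :
    M.IsFlat (A : Set α) ↔ ∀ e ∈ E, e ∉ A → M.rk A < M.rk (insert e A) := by
  have hA' : (A : Set α) ⊆ M.E := by rw [hE]; exact_mod_cast hA
  rw [isFlat_iff_closure_eq]
  refine ⟨fun h e he heA ↦ ?_, fun h ↦ (M.subset_closure _ hA').antisymm' fun e he ↦ ?_⟩
  · rw [← not_le, ← mem_closure_iff_rk (by rw [hE]; exact_mod_cast he), h]
    exact_mod_cast heA
  · have heE := M.closure_subset_ground _ he
    by_contra heA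
    rw [mem_closure_iff_rk heE] at he
    exact (h e (by rw [hE] at heE; exact_mod_cast heE) (by exact_mod_cast heA)).not_ge he

lemma isCyclicSet_coe_iff (hE : M.E = E) (hA : A ⊆ E) :
    M.IsCyclicSet (A : Set α) ↔ ∀ e ∈ A, M.rk A ≤ M.rk (A.erase e) := by
  have key : ∀ e ∈ A, (M.rk A ≤ M.rk (A.erase e) ↔ ∃ C ⊆ (A : Set α), M.IsCircuit C ∧ e ∈ C) := by
    intro e he
    have heE : e ∈ M.E := by rw [hE]; exact_mod_cast hA he
    have h1 := mem_closure_iff_rk (A := A.erase e) heE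
    rw [insert_erase he] at h1
    rw [← h1, mem_closure_iff_exists_isCircuit (by simp)]
    refine ⟨?_, ?_⟩
    · rintro ⟨C, hCA, hC, heC⟩
      refine ⟨C, hCA.trans ?_, hC, heC⟩
      rw [← coe_insert, insert_erase he]
    · rintro ⟨C, hCA, hC, heC⟩
      refine ⟨C, ?_, hC, heC⟩
      rwa [← coe_insert, insert_erase he]
  constructor
  · rintro ⟨𝒞, h𝒞, hA𝒞⟩ e he
    rw [key e he]
    have : e ∈ (A : Set α) := by exact_mod_cast he
    rw [hA𝒞] at this
    obtain ⟨C, hC, heC⟩ := this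
    exact ⟨C, hA𝒞 ▸ Set.subset_sUnion_of_mem hC, h𝒞 C hC, heC⟩
  · intro h
    refine ⟨{C | C ⊆ (A : Set α) ∧ M.IsCircuit C}, fun C hC ↦ hC.2, Set.Subset.antisymm ?_ ?_⟩
    · intro e he
      obtain ⟨C, hCA, hC, heC⟩ := (key e (by exact_mod_cast he)).1 (h e (by exact_mod_cast he))
      exact ⟨C, ⟨hCA, hC⟩, heC⟩
    · exact Set.sUnion_subset fun C hC ↦ hC.1

/-- Flatness means that adding any element raises the rank, cyclicity that removing any element does
not lower it. From here on, cyclic flats are handled purely by rank arithmetic. -/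
lemma isCyclicFlat_coe_iff (hE : M.E = E) (hA : A ⊆ E) :
    M.IsCyclicFlat (A : Set α) ↔ (∀ e ∈ E, e ∉ A → M.rk A < M.rk (insert e A)) ∧
      ∀ e ∈ A, M.rk A ≤ M.rk (A.erase e) := by
  rw [IsCyclicFlat, isFlat_coe_iff hE hA, isCyclicSet_coe_iff hE hA]

/-- The rank of a set is determined by the cyclic flats and their ranks. -/
lemma exists_isCyclicFlat_rk_eq (hE : M.E = E) (A : Finset α) :
    ∃ Z ⊆ E, M.IsCyclicFlat (Z : Set α) ∧ M.rk A = M.rk Z + #((A ∩ E) \ Z) := by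
  have hne : {Z ∈ E.powerset | M.rk A = M.rk Z + #((A ∩ E) \ Z)}.Nonempty :=
    ⟨A ∩ E, by simp [rk_inter_ground hE]⟩
  -- The weight orders lexicographically: least rank, then largest set. Adding an element of the
  -- closure keeps the rank and enlarges `Z`; removing a coloop of `Z` lowers the rank. Both
  -- preserve the defining equality, so the minimiser is a cyclic flat.
  obtain ⟨Z, hZ, hmin⟩ := exists_min_image _ (fun Z ↦ M.rk Z * (#E + 1) + #(E \ Z)) hne
  simp only [mem_filter, mem_powerset] at hZ hmin
  obtain ⟨hZE, hZ⟩ := hZ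
  refine ⟨Z, hZE, (isCyclicFlat_coe_iff hE hZE).2 ⟨fun e he heZ ↦ ?_, fun e he ↦ ?_⟩, hZ⟩
  · by_contra! hcon
    have h0 := M.rk_mono (subset_insert e Z)
    have h1 := hmin (insert e Z) ⟨insert_subset he hZE, ?_⟩
    · have : #(E \ insert e Z) < #(E \ Z) := card_lt_card <| by
        rw [ssubset_iff_of_subset (sdiff_subset_sdiff subset_rfl (subset_insert _ _))]
        exact ⟨e, by simp [he, heZ]⟩
      rw [hcon.antisymm h0] at h1
      omega
    · have h2 : #((A ∩ E) \ insert e Z) ≤ #((A ∩ E) \ Z) :=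
        card_le_card (sdiff_subset_sdiff subset_rfl (subset_insert _ _))
      have h3 := M.rk_le_rk_add_card_sdiff (A ∩ E) (insert e Z)
      rw [rk_inter_ground hE] at h3
      omega
  · by_contra! hcon
    have h1 := hmin (Z.erase e) ⟨(erase_subset _ _).trans hZE, ?_⟩
    · have h2 : #(E \ Z.erase e) ≤ #E := card_le_card sdiff_subset
      have h3 : (M.rk (Z.erase e) + 1) * (#E + 1) ≤ M.rk Z * (#E + 1) := Nat.mul_le_mul_right _ hcon
      rw [add_mul] at h3
      omega
    · have h2 : #((A ∩ E) \ Z.erase e) ≤ #((A ∩ E) \ Z) + 1 := by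
        refine (card_le_card (t := insert e ((A ∩ E) \ Z)) fun x ↦ ?_).trans (card_insert_le _ _)
        simp
        tauto
      have h3 := M.rk_le_rk_add_card_sdiff (A ∩ E) (Z.erase e)
      rw [rk_inter_ground hE] at h3
      omega

end Rank

/-! ### The glued rank function, its matroid, and the cyclic flats of that matroid -/

section Glue

variable {α : Type*} [DecidableEq α] {M M₁ M₂ N : Matroid α}
  {S C U S₁ C₁ U₁ S₂ C₂ U₂ E A B F Z : Finset α} {k d : ℕ} {e : α}

/-- The rank bound that comes from `M` by freely coextending by `C` and freely extending by `U`. -/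
noncomputable def liftRk (M : Matroid α) (C U A : Finset α) : ℕ := M.rk A + #C + #(A ∩ U)

/-- The set `E` is partitioned into the ground set `S` of `M`, a set `C` with `|C| = k - r(M)`, and
a set `U`. -/
structure IsSplit (M : Matroid α) (S C U E : Finset α) (k : ℕ) : Prop where
  ground : M.E = S
  union : S ∪ C ∪ U = E
  disjSC : Disjoint S C
  disjSU : Disjoint S U
  disjCU : Disjoint C U
  card : #C + M.rk S = k

namespace IsSplit

variable (h : IsSplit M S C U E k)

include h

lemma subset : S ⊆ E := by
  rw [← h.union, union_assoc]; exact subset_union_left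

lemma subset_C : C ⊆ E := by
  rw [← h.union, union_right_comm]; exact subset_union_right

lemma subset_U : U ⊆ E := by
  rw [← h.union]; exact subset_union_right

lemma mem_cases (he : e ∈ E) : e ∈ S ∨ e ∈ C ∨ e ∈ U := by
  rw [← h.union] at he; simpa [or_assoc] using he

lemma notMem_of_mem_S (he : e ∈ S) : e ∉ C ∧ e ∉ U :=
  ⟨disjoint_left.1 h.disjSC he, disjoint_left.1 h.disjSU he⟩

lemma notMem_of_mem_C (he : e ∈ C) : e ∉ S ∧ e ∉ U :=
  ⟨disjoint_right.1 h.disjSC he, disjoint_left.1 h.disjCU he⟩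

lemma notMem_of_mem_U (he : e ∈ U) : e ∉ S ∧ e ∉ C :=
  ⟨disjoint_right.1 h.disjSU he, disjoint_right.1 h.disjCU he⟩

lemma rk_congr (hAB : ∀ x ∈ S, x ∈ A ↔ x ∈ B) : M.rk A = M.rk B := by
  rw [← rk_inter_ground h.ground, ← rk_inter_ground h.ground B]
  congr 1
  ext x
  by_cases hx : x ∈ S <;> simp [hx, hAB]

lemma card_sdiff_eq (hA : A ⊆ E) (hF : F ⊆ S) :
    #(A \ (F ∪ C)) = #((A ∩ S) \ F) + #(A ∩ U) := by
  rw [← card_union_of_disjoint]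
  · congr 1
    ext x
    have h1 := h.notMem_of_mem_S (e := x)
    have h2 := h.notMem_of_mem_C (e := x)
    have h3 := h.notMem_of_mem_U (e := x)
    have h4 := @hF x
    have h5 : x ∈ A → _ := fun hx ↦ h.mem_cases (hA hx)
    simp
    tauto
  · refine disjoint_left.2 fun x hx hx' ↦ ?_
    simp only [mem_sdiff, mem_inter] at hx hx'
    exact (h.notMem_of_mem_S hx.1.2).2 hx'.2

lemma card_eq (hA : A ⊆ E) : #A = #(A ∩ S) + #(A ∩ C) + #(A ∩ U) := by
  have h1 := h.card_sdiff_eq hA (empty_subset _)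
  rw [empty_union, sdiff_empty] at h1
  have h2 := card_inter_add_card_sdiff A C
  omega

lemma card_E : #E + M.rk S = k + #S + #U := by
  have h1 := h.card_eq subset_rfl
  rw [inter_eq_right.2 h.subset, inter_eq_right.2 h.subset_C, inter_eq_right.2 h.subset_U] at h1
  have h2 := h.card
  omega

lemma rk_le (A : Finset α) : M.rk A ≤ M.rk S := rk_le_rk_ground h.ground A

omit h in
lemma liftRk_mono (hAB : A ⊆ B) : liftRk M C U A ≤ liftRk M C U B := by
  have h1 := M.rk_mono hAB
  have h2 := card_le_card (inter_subset_inter_right (u := U) hAB)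
  simp only [liftRk]
  omega

omit h in
lemma liftRk_submod (A B : Finset α) :
    liftRk M C U (A ∩ B) + liftRk M C U (A ∪ B) ≤ liftRk M C U A + liftRk M C U B := by
  have h1 := M.rk_submod A B
  have h2 := card_inter_add_card_union (A ∩ U) (B ∩ U)
  rw [← inter_inter_distrib_right, ← union_inter_distrib_right] at h2
  simp only [liftRk]
  omega

/-- The sets `S` and `U` are disjoint, so a new element increases at most one of the terms `M.rk A`
and `#(A ∩ U)`. -/
lemma liftRk_le_add (A B : Finset α) : liftRk M C U A ≤ liftRk M C U B + #(A \ B) := by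
  have h1 := M.rk_le_rk_add_card_sdiff (A ∩ S) B
  rw [rk_inter_ground h.ground] at h1
  have h2 : #(A ∩ U) ≤ #(B ∩ U) + #((A ∩ U) \ B) := by
    refine (card_le_card fun x hx ↦ ?_).trans (card_union_le _ _)
    simp only [mem_inter, mem_union, mem_sdiff] at *
    tauto
  have h3 : #((A ∩ S) \ B) + #((A ∩ U) \ B) ≤ #(A \ B) := by
    rw [← card_union_of_disjoint]
    · refine card_le_card fun x ↦ ?_
      simp
      tauto
    · refine disjoint_left.2 fun x hx hx' ↦ ?_
      simp only [mem_sdiff, mem_inter] at hx hx'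
      exact (h.notMem_of_mem_S hx.1.2).2 hx'.1.2
  simp only [liftRk]
  omega

/-- For `liftRk`, the elements of `C` act as loops, those of `U` as coloops, and those of `S` as in
`M`. This trichotomy drives all later arguments about where elements can lie. -/
lemma liftRk_insert_of_mem_C (he : e ∈ C) (A : Finset α) :
    liftRk M C U (insert e A) = liftRk M C U A := by
  obtain ⟨h1, h2⟩ := h.notMem_of_mem_C he
  rw [liftRk, liftRk, rk_insert_of_notMem h.ground h1, insert_inter_of_notMem h2]

lemma liftRk_erase_of_mem_C (he : e ∈ C) (A : Finset α) :
    liftRk M C U (A.erase e) = liftRk M C U A := by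
  obtain ⟨h1, h2⟩ := h.notMem_of_mem_C he
  rw [liftRk, liftRk, rk_erase_of_notMem h.ground h1, erase_inter, erase_eq_of_notMem (a := e)]
  simp [h2]

lemma liftRk_insert_of_mem_U (he : e ∈ U) (heA : e ∉ A) :
    liftRk M C U (insert e A) = liftRk M C U A + 1 := by
  obtain ⟨h1, h2⟩ := h.notMem_of_mem_U he
  rw [liftRk, liftRk, rk_insert_of_notMem h.ground h1, insert_inter_of_mem he,
    card_insert_of_notMem (by simp [heA])]
  omega

lemma liftRk_erase_of_mem_U (he : e ∈ U) (heA : e ∈ A) :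
    liftRk M C U (A.erase e) + 1 = liftRk M C U A := by
  rw [← h.liftRk_insert_of_mem_U he (notMem_erase e A), insert_erase heA]

lemma liftRk_insert_of_mem_S (he : e ∈ S) (A : Finset α) :
    liftRk M C U (insert e A) = M.rk (insert e A) + #C + #(A ∩ U) := by
  rw [liftRk, insert_inter_of_notMem (h.notMem_of_mem_S he).2]

lemma liftRk_erase_of_mem_S (he : e ∈ S) (A : Finset α) :
    liftRk M C U (A.erase e) = M.rk (A.erase e) + #C + #(A ∩ U) := by
  rw [liftRk, erase_inter, erase_eq_of_notMem (s := A ∩ U)]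
  simp [(h.notMem_of_mem_S he).2]

lemma liftRk_union_C (hF : F ⊆ S) : liftRk M C U (F ∪ C) = M.rk F + #C := by
  have h1 : (F ∪ C) ∩ U = ∅ := by
    ext x
    have h3 := h.notMem_of_mem_U (e := x)
    have h4 := @hF x
    simp
    tauto
  rw [liftRk, h1, card_empty, add_zero, h.rk_congr (B := F)]
  intro x hx
  simp [(h.notMem_of_mem_S hx).1]

end IsSplit

/-- The common rank function of the matroids constructed from `M₁` and `M₂`. -/
noncomputable def glueRk (M₁ M₂ : Matroid α) (C₁ U₁ C₂ U₂ : Finset α) (k : ℕ) (A : Finset α) : ℕ :=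
  min (min #A k) (min (liftRk M₁ C₁ U₁ A) (liftRk M₂ C₂ U₂ A))

lemma glueRk_comm : glueRk M₁ M₂ C₁ U₁ C₂ U₂ k A = glueRk M₂ M₁ C₂ U₂ C₁ U₁ k A := by
  rw [glueRk, glueRk, min_comm (liftRk M₁ C₁ U₁ A)]

lemma glueRk_spec : glueRk M₁ M₂ C₁ U₁ C₂ U₂ k A ≤ #A ∧ glueRk M₁ M₂ C₁ U₁ C₂ U₂ k A ≤ k ∧
    glueRk M₁ M₂ C₁ U₁ C₂ U₂ k A ≤ liftRk M₁ C₁ U₁ A ∧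
    glueRk M₁ M₂ C₁ U₁ C₂ U₂ k A ≤ liftRk M₂ C₂ U₂ A ∧
    (glueRk M₁ M₂ C₁ U₁ C₂ U₂ k A = #A ∨ glueRk M₁ M₂ C₁ U₁ C₂ U₂ k A = k ∨
    glueRk M₁ M₂ C₁ U₁ C₂ U₂ k A = liftRk M₁ C₁ U₁ A ∨
    glueRk M₁ M₂ C₁ U₁ C₂ U₂ k A = liftRk M₂ C₂ U₂ A) := by
  rw [glueRk]
  omega

/-- Two splits of the same set `E`, far enough apart for `glueRk` to be a rank function. -/
structure IsGluing (M₁ M₂ : Matroid α) (S₁ C₁ U₁ S₂ C₂ U₂ E : Finset α) (k d : ℕ) : Prop where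
  split₁ : IsSplit M₁ S₁ C₁ U₁ E k
  split₂ : IsSplit M₂ S₂ C₂ U₂ E k
  gap : ∀ A ⊆ E, ∀ B ⊆ E, 2 * k + #(A ∩ B) ≤ liftRk M₁ C₁ U₁ A + liftRk M₂ C₂ U₂ B + d
  add_le₁ : d + M₁.rk S₁ ≤ k
  add_le₂ : d + M₂.rk S₂ ≤ k

/-- `N` is the matroid with rank function `glueRk`. -/
structure IsGlued (M₁ M₂ : Matroid α) (C₁ U₁ C₂ U₂ E : Finset α) (k : ℕ) (N : Matroid α) :
    Prop where
  ground : N.E = E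
  rk_eq : ∀ A ⊆ E, N.rk A = glueRk M₁ M₂ C₁ U₁ C₂ U₂ k A

lemma IsGlued.symm (h : IsGlued M₁ M₂ C₁ U₁ C₂ U₂ E k N) : IsGlued M₂ M₁ C₂ U₂ C₁ U₁ E k N :=
  ⟨h.ground, fun A hA ↦ (h.rk_eq A hA).trans glueRk_comm⟩

lemma IsGlued.spec (h : IsGlued M₁ M₂ C₁ U₁ C₂ U₂ E k N) (hA : A ⊆ E) :
    N.rk A ≤ #A ∧ N.rk A ≤ k ∧ N.rk A ≤ liftRk M₁ C₁ U₁ A ∧ N.rk A ≤ liftRk M₂ C₂ U₂ A ∧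
    (N.rk A = #A ∨ N.rk A = k ∨ N.rk A = liftRk M₁ C₁ U₁ A ∨ N.rk A = liftRk M₂ C₂ U₂ A) := by
  rw [h.rk_eq A hA]
  exact glueRk_spec

namespace IsGluing

variable (h : IsGluing M₁ M₂ S₁ C₁ U₁ S₂ C₂ U₂ E k d)

include h

lemma symm : IsGluing M₂ M₁ S₂ C₂ U₂ S₁ C₁ U₁ E k d where
  split₁ := h.split₂
  split₂ := h.split₁
  gap A hA B hB := by
    have := h.gap B hB A hA
    rw [inter_comm] at this
    omega
  add_le₁ := h.add_le₂
  add_le₂ := h.add_le₁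

/-- The gap inequality with `B = A`: the second bound is at least `2k - d`. So the two lifts never
compete on one set. -/
lemma le_of_lt (hA : A ⊆ E) (hlt : liftRk M₁ C₁ U₁ A ≤ #A) : k ≤ liftRk M₂ C₂ U₂ A := by
  have h1 := h.gap A hA A hA
  have h2 := h.add_le₁
  rw [inter_self] at h1
  omega

/-- The gap inequality at two empty sets says that the two ranks sum to at most `d`, and `d ≤ k`. -/
lemma rk_add_rk_le : M₁.rk S₁ + M₂.rk S₂ ≤ k := by
  have h1 := h.gap ∅ (empty_subset _) ∅ (empty_subset _)
  simp only [liftRk, rk_empty, empty_inter, card_empty] at h1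
  have h2 := h.split₁.card
  have h3 := h.split₂.card
  have h4 := h.add_le₁
  omega

theorem exists_isGlued : ∃ N, IsGlued M₁ M₂ C₁ U₁ C₂ U₂ E k N := by
  suffices hex : ∃ N : Matroid α, N.E = E ∧ ∀ A ⊆ E, N.rk A = glueRk M₁ M₂ C₁ U₁ C₂ U₂ k A from
    hex.imp fun N hN ↦ ⟨hN.1, hN.2⟩
  refine exists_matroid_of_rankFn E _ (fun A _ ↦ glueRk_spec.1) (fun A B hAB _ ↦ ?_)
    (fun A B hA hB ↦ ?_)
  · rw [glueRk, glueRk]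
    exact min_le_min (min_le_min (card_le_card hAB) le_rfl)
      (min_le_min (IsSplit.liftRk_mono hAB) (IsSplit.liftRk_mono hAB))
  · have hI := glueRk_spec (M₁ := M₁) (M₂ := M₂) (C₁ := C₁) (U₁ := U₁) (C₂ := C₂) (U₂ := U₂) (k := k)
      (A := A ∩ B)
    have hJ := glueRk_spec (M₁ := M₁) (M₂ := M₂) (C₁ := C₁) (U₁ := U₁) (C₂ := C₂) (U₂ := U₂) (k := k)
      (A := A ∪ B)
    have hc := card_inter_add_card_union A B
    have hd1 := card_inter_add_card_sdiff A B
    have hd2 := card_inter_add_card_sdiff B A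
    rw [inter_comm] at hd2
    have hd := h.add_le₁
    have s1 := IsSplit.liftRk_submod (M := M₁) (C := C₁) (U := U₁) A B
    have s2 := IsSplit.liftRk_submod (M := M₂) (C := C₂) (U := U₂) A B
    have a1 := h.split₁.liftRk_le_add (A ∪ B) A
    have a2 := h.split₂.liftRk_le_add (A ∪ B) A
    have b1 := h.split₁.liftRk_le_add (A ∪ B) B
    have b2 := h.split₂.liftRk_le_add (A ∪ B) B
    rw [union_sdiff_left] at a1 a2
    rw [union_sdiff_right] at b1 b2
    have m1 := IsSplit.liftRk_mono (M := M₁) (C := C₁) (U := U₁) (inter_subset_left (s₁ := A) (s₂ := B))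
    have m2 := IsSplit.liftRk_mono (M := M₂) (C := C₂) (U := U₂) (inter_subset_left (s₁ := A) (s₂ := B))
    have n1 := IsSplit.liftRk_mono (M := M₁) (C := C₁) (U := U₁) (inter_subset_right (s₁ := A) (s₂ := B))
    have n2 := IsSplit.liftRk_mono (M := M₂) (C := C₂) (U := U₂) (inter_subset_right (s₁ := A) (s₂ := B))
    have g1 := h.gap A hA B hB
    have g2 := h.gap B hB A hA
    rw [inter_comm B A] at g2
    obtain ⟨hI1, hI2, hI3, hI4, -⟩ := hI
    obtain ⟨hJ1, hJ2, hJ3, hJ4, -⟩ := hJ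
    -- Sixteen cases, by the bounds attained at `A` and `B`. The same lift twice: it is submodular.
    -- A lift and a cardinality: the lift grows by at most one per element. A case with `k`:
    -- monotonicity. Two different lifts: their sum is at least `k + |A ∩ B|` by the gap inequality.
    obtain ⟨-, -, -, -, hA' | hA' | hA' | hA'⟩ := glueRk_spec (M₁ := M₁) (M₂ := M₂) (C₁ := C₁)
      (U₁ := U₁) (C₂ := C₂) (U₂ := U₂) (k := k) (A := A) <;>
    obtain ⟨-, -, -, -, hB' | hB' | hB' | hB'⟩ := glueRk_spec (M₁ := M₁) (M₂ := M₂) (C₁ := C₁)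
      (U₁ := U₁) (C₂ := C₂) (U₂ := U₂) (k := k) (A := B) <;>
    omega

/-- On `F ∪ C₁` the first lift is at most the cardinality and at most `k`, so the second lift is at
least `k` and plays no role. -/
lemma rk_union_C (hN : IsGlued M₁ M₂ C₁ U₁ C₂ U₂ E k N) (hF : F ⊆ S₁) :
    N.rk (F ∪ C₁) = M₁.rk F + #C₁ := by
  have hFE : F ∪ C₁ ⊆ E := union_subset (hF.trans h.split₁.subset) h.split₁.subset_C
  have h1 := hN.spec hFE
  have h2 := h.split₁.liftRk_union_C hF
  have h3 : #(F ∪ C₁) = #F + #C₁ := card_union_of_disjoint (h.split₁.disjSC.mono_left hF)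
  have h4 := M₁.rk_le_card F
  have h5 := h.le_of_lt hFE (by omega)
  have h6 := h.split₁.card
  have h7 := h.split₁.rk_le F
  omega

lemma rk_ground (hN : IsGlued M₁ M₂ C₁ U₁ C₂ U₂ E k N) : N.rk E = k := by
  have h1 := h.rk_union_C hN subset_rfl
  have h2 := h.split₁.card
  have h3 := rk_le_rk_ground hN.ground (S₁ ∪ C₁)
  have h4 := (hN.spec subset_rfl).2.1
  omega

/-- A proper flat has rank below `r(M₁)` and a nonempty cyclic set is dependent, so the first lift
is strictly below both `k` and the cardinality at `F ∪ C₁`. It therefore still governs the rank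
after one element is added or removed, and it is strictly increasing, respectively unchanged, there.
-/
lemma isCyclicFlat_union_C (hN : IsGlued M₁ M₂ C₁ U₁ C₂ U₂ E k N) (hF : F ⊆ S₁)
    (hFc : M₁.IsCyclicFlat (F : Set α)) (hne : F.Nonempty) (hprop : F ≠ S₁) :
    N.IsCyclicFlat ((F ∪ C₁ : Finset α) : Set α) := by
  have hFE : F ∪ C₁ ⊆ E := union_subset (hF.trans h.split₁.subset) h.split₁.subset_C
  have hrk := h.rk_union_C hN hF
  have hg := h.split₁.liftRk_union_C hF
  have hk := h.split₁.card
  have hcard : #(F ∪ C₁) = #F + #C₁ := card_union_of_disjoint (h.split₁.disjSC.mono_left hF)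
  rw [isCyclicFlat_coe_iff h.split₁.ground hF] at hFc
  have hlt : M₁.rk F < M₁.rk S₁ := by
    obtain ⟨e, he, heF⟩ := exists_of_ssubset (hF.ssubset_of_ne hprop)
    exact (hFc.1 e he heF).trans_le (h.split₁.rk_le _)
  have hltF : M₁.rk F < #F := by
    obtain ⟨e, he⟩ := hne
    have h1 := hFc.2 e he
    have h2 := M₁.rk_le_card (F.erase e)
    have h3 := card_erase_add_one he
    omega
  have hg2 := h.le_of_lt hFE (by omega)
  rw [isCyclicFlat_coe_iff hN.ground hFE]
  refine ⟨fun e he heF ↦ ?_, fun e he ↦ ?_⟩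
  · have h1 := hN.spec (insert_subset he hFE)
    have h2 := card_insert_of_notMem heF
    have h3 := IsSplit.liftRk_mono (M := M₂) (C := C₂) (U := U₂) (subset_insert e (F ∪ C₁))
    have h4 : liftRk M₁ C₁ U₁ (F ∪ C₁) < liftRk M₁ C₁ U₁ (insert e (F ∪ C₁)) := by
      simp only [mem_union, not_or] at heF
      obtain h' | h' | h' := h.split₁.mem_cases he
      · have h5 := hFc.1 e h' heF.1
        have h6 : M₁.rk (insert e (F ∪ C₁)) = M₁.rk (insert e F) := h.split₁.rk_congr fun x hx ↦ by
          simp [(h.split₁.notMem_of_mem_S hx).1]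
        rw [h.split₁.liftRk_insert_of_mem_S h', hg]
        omega
      · exact absurd h' heF.2
      · rw [h.split₁.liftRk_insert_of_mem_U h' (by simp [heF])]
        omega
    omega
  · have h1 := hN.spec ((erase_subset e _).trans hFE)
    have h2 := card_erase_add_one he
    have h4 : liftRk M₁ C₁ U₁ (F ∪ C₁) ≤ liftRk M₁ C₁ U₁ ((F ∪ C₁).erase e) := by
      obtain h' | h' := mem_union.1 he
      · have h5 := hFc.2 e h'
        have h6 : M₁.rk ((F ∪ C₁).erase e) = M₁.rk (F.erase e) := h.split₁.rk_congr fun x hx ↦ by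
          simp [(h.split₁.notMem_of_mem_S hx).1]
        rw [h.split₁.liftRk_erase_of_mem_S (hF h'), hg]
        omega
      · rw [h.split₁.liftRk_erase_of_mem_C h']
    have h5 := IsSplit.liftRk_mono (M := M₁) (C := C₁) (U := U₁) (erase_subset e (F ∪ C₁))
    have h6 := h.le_of_lt ((erase_subset e _).trans hFE) (by omega)
    omega

lemma isCyclicFlat_empty (hN : IsGlued M₁ M₂ C₁ U₁ C₂ U₂ E k N) (h₁ : 0 < M₁.rk S₁)
    (h₂ : 0 < M₂.rk S₂) : N.IsCyclicFlat ((∅ : Finset α) : Set α) := by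
  rw [isCyclicFlat_coe_iff hN.ground (empty_subset _)]
  refine ⟨fun e he _ ↦ ?_, by simp⟩
  have h1 := hN.spec (insert_subset he (empty_subset _))
  have h2 := h.rk_add_rk_le
  have h3 := h.split₁.card
  have h4 := h.split₂.card
  have h5 : #(insert e (∅ : Finset α)) = 1 := by simp
  simp only [liftRk] at h1
  rw [rk_empty]
  omega

/-- Removing one element leaves every bound at least `k`: for the lifts because `M₁` and `M₂` have
no coloops, for the cardinality because `r(M₁) < |S₁|` makes `|E| > k`. -/
lemma isCyclicFlat_ground (hN : IsGlued M₁ M₂ C₁ U₁ C₂ U₂ E k N)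
    (h₁ : ∀ e ∈ S₁, M₁.rk S₁ ≤ M₁.rk (S₁.erase e)) (h₂ : ∀ e ∈ S₂, M₂.rk S₂ ≤ M₂.rk (S₂.erase e))
    (hlt : M₁.rk S₁ < #S₁) : N.IsCyclicFlat (E : Set α) := by
  have key : ∀ {M : Matroid α} {S C U : Finset α}, IsSplit M S C U E k →
      (∀ e ∈ S, M.rk S ≤ M.rk (S.erase e)) → ∀ e ∈ E, k ≤ liftRk M C U (E.erase e) := by
    intro M S C U hs hS e he
    have h1 := hs.card
    have h2 : M.rk S ≤ M.rk (E.erase e) := by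
      by_cases heS : e ∈ S
      · exact (hS e heS).trans (M.rk_mono (erase_subset_erase _ hs.subset))
      · exact M.rk_mono (subset_erase.2 ⟨hs.subset, heS⟩)
    simp only [liftRk]
    omega
  rw [isCyclicFlat_coe_iff hN.ground subset_rfl]
  refine ⟨fun e he he' ↦ absurd he he', fun e he ↦ ?_⟩
  have h1 := hN.spec (erase_subset e E)
  have h2 := key h.split₁ h₁ e he
  have h3 := key h.split₂ h₂ e he
  have h4 := card_erase_add_one he
  have h5 := h.split₁.card_E
  rw [h.rk_ground hN]
  omega

/-- The first lift is attained at `Z`. A flat then contains the loops `C₁` of the lift, and a cyclic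
set avoids its coloops `U₁`, so that `Z` is `C₁` together with a part of `S₁`, which inherits both
properties. -/
lemma exists_of_isCyclicFlat (hN : IsGlued M₁ M₂ C₁ U₁ C₂ U₂ E k N) (hZE : Z ⊆ E)
    (hZ : N.IsCyclicFlat (Z : Set α)) (hne : N.rk Z ≠ #Z) (hnek : N.rk Z ≠ k)
    (hr : N.rk Z = liftRk M₁ C₁ U₁ Z) :
    ∃ F ⊆ S₁, M₁.IsCyclicFlat (F : Set α) ∧ F.Nonempty ∧ F ≠ S₁ ∧ Z = F ∪ C₁ := by
  rw [isCyclicFlat_coe_iff hN.ground hZE] at hZ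
  have hins : ∀ e ∈ E, e ∉ Z → liftRk M₁ C₁ U₁ Z < liftRk M₁ C₁ U₁ (insert e Z) := fun e he heZ ↦
    hr ▸ (hZ.1 e he heZ).trans_le (hN.spec (insert_subset he hZE)).2.2.1
  have hera : ∀ e ∈ Z, liftRk M₁ C₁ U₁ Z ≤ liftRk M₁ C₁ U₁ (Z.erase e) := fun e he ↦
    hr ▸ (hZ.2 e he).trans (hN.spec ((erase_subset e Z).trans hZE)).2.2.1
  have hs := h.split₁
  have hCZ : C₁ ⊆ Z := by
    intro e he
    by_contra heZ
    have := hins e (hs.subset_C he) heZ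
    rw [hs.liftRk_insert_of_mem_C he] at this
    omega
  have hUZ : ∀ e ∈ Z, e ∉ U₁ := by
    intro e he heU
    have h1 := hera e he
    have h2 := hs.liftRk_erase_of_mem_U heU he
    omega
  have hZeq : Z = Z ∩ S₁ ∪ C₁ := by
    ext x
    have h1 := hUZ x
    have h2 := @hCZ x
    have h3 : x ∈ Z → _ := fun hx ↦ hs.mem_cases (hZE hx)
    simp
    tauto
  have hg : liftRk M₁ C₁ U₁ Z = M₁.rk (Z ∩ S₁) + #C₁ := by
    conv_lhs => rw [hZeq]
    exact hs.liftRk_union_C inter_subset_right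
  have hcard : #Z = #(Z ∩ S₁) + #C₁ := by
    conv_lhs => rw [hZeq]
    exact card_union_of_disjoint (hs.disjSC.mono_left inter_subset_right)
  have hU : #(Z ∩ U₁) = 0 := by
    rw [card_eq_zero, ← disjoint_iff_inter_eq_empty, disjoint_left]
    exact hUZ
  refine ⟨Z ∩ S₁, inter_subset_right, ?_, ?_, ?_, hZeq⟩
  · rw [isCyclicFlat_coe_iff hs.ground inter_subset_right]
    refine ⟨fun e he heZ ↦ ?_, fun e he ↦ ?_⟩
    · have h1 := hins e (hs.subset he) (fun h' ↦ heZ (by simp [h', he]))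
      rw [hs.liftRk_insert_of_mem_S he, hU, hg] at h1
      rw [hs.rk_congr (A := insert e (Z ∩ S₁)) (B := insert e Z) fun x hx ↦ by simp [hx]]
      omega
    · simp only [mem_inter] at he
      have h1 := hera e he.1
      rw [hs.liftRk_erase_of_mem_S he.2, hU, hg] at h1
      rw [hs.rk_congr (A := (Z ∩ S₁).erase e) (B := Z.erase e) fun x hx ↦ by simp [hx]]
      omega
  · rw [nonempty_iff_ne_empty]
    intro h0
    rw [h0] at hg hcard
    rw [rk_empty] at hg
    simp only [card_empty] at hcard
    omega
  · intro h0
    rw [h0] at hg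
    have := hs.card
    omega

theorem isCyclicFlat_iff (hN : IsGlued M₁ M₂ C₁ U₁ C₂ U₂ E k N)
    (hr₁ : 0 < M₁.rk S₁) (hr₂ : 0 < M₂.rk S₂)
    (h₁ : ∀ e ∈ S₁, M₁.rk S₁ ≤ M₁.rk (S₁.erase e)) (h₂ : ∀ e ∈ S₂, M₂.rk S₂ ≤ M₂.rk (S₂.erase e))
    (hlt : M₁.rk S₁ < #S₁) (hZE : Z ⊆ E) : N.IsCyclicFlat (Z : Set α) ↔
    (∃ F ⊆ S₁, M₁.IsCyclicFlat (F : Set α) ∧ F.Nonempty ∧ F ≠ S₁ ∧ Z = F ∪ C₁) ∨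
    (∃ F ⊆ S₂, M₂.IsCyclicFlat (F : Set α) ∧ F.Nonempty ∧ F ≠ S₂ ∧ Z = F ∪ C₂) ∨
    Z = ∅ ∨ Z = E := by
  constructor
  -- If the rank equals the cardinality, `Z` is independent and cyclic, hence empty; if it equals
  -- `k`, `Z` is a spanning flat. Otherwise one of the lifts is attained.
  · intro hZ
    by_cases hc : N.rk Z = #Z
    · right; right; left
      rw [isCyclicFlat_coe_iff hN.ground hZE] at hZ
      rw [eq_empty_iff_forall_notMem]
      intro e he
      have h1 := hZ.2 e he
      have h2 := card_erase_add_one he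
      have h3 := N.rk_le_card (Z.erase e)
      omega
    by_cases hk : N.rk Z = k
    · right; right; right
      rw [isCyclicFlat_coe_iff hN.ground hZE] at hZ
      by_contra hne
      obtain ⟨e, he, heZ⟩ := exists_of_ssubset (hZE.ssubset_of_ne hne)
      have h1 := hZ.1 e he heZ
      have h2 := (hN.spec (insert_subset he hZE)).2.1
      omega
    obtain ⟨-, -, -, -, h' | h' | h' | h'⟩ := hN.spec hZE
    · exact absurd h' hc
    · exact absurd h' hk
    · exact .inl (h.exists_of_isCyclicFlat hN hZE hZ hc hk h')
    · exact .inr (.inl (h.symm.exists_of_isCyclicFlat hN.symm hZE hZ hc hk h'))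
  · rintro (⟨F, hF, hFc, hne, hp, rfl⟩ | ⟨F, hF, hFc, hne, hp, rfl⟩ | rfl | rfl)
    · exact h.isCyclicFlat_union_C hN hF hFc hne hp
    · exact h.symm.isCyclicFlat_union_C hN.symm hF hFc hne hp
    · exact h.isCyclicFlat_empty hN hr₁ hr₂
    · exact h.isCyclicFlat_ground hN h₁ h₂ hlt

omit h in
/-- An upper bound for the rank function of a matroid with the prescribed cyclic flats. -/
lemma rk_le_liftRk (hs : IsSplit M S C U E k) (hNE : N.E = E) (hk : N.rk E ≤ k)
    (hF : ∀ F ⊆ S, M.IsCyclicFlat (F : Set α) → F.Nonempty → F ≠ S → N.rk (F ∪ C) = M.rk F + #C)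
    (hA : A ⊆ E) : N.rk A ≤ liftRk M C U A := by
  obtain ⟨F, hFS, hFc, hFr⟩ := exists_isCyclicFlat_rk_eq hs.ground A
  simp only [liftRk, hFr]
  obtain rfl | hne := F.eq_empty_or_nonempty
  · have h1 := hs.card_eq hA
    have h2 := N.rk_le_card A
    have h3 := card_le_card (inter_subset_right (s₁ := A) (s₂ := C))
    rw [sdiff_empty]
    omega
  by_cases hp : F = S
  · subst hp
    have h1 := hs.card
    have h2 := rk_le_rk_ground hNE A
    omega
  have h1 := hF F hFS hFc hne hp
  have h2 := N.rk_le_rk_add_card_sdiff A (F ∪ C)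
  rw [hs.card_sdiff_eq hA hFS] at h2
  omega

/-- This gives uniqueness. The four bounds hold in `N`, and one of them is attained at each `A`: the
rank is `N.rk Z + |A \ Z|` for some cyclic flat `Z`, and each kind of `Z` accounts for one of the
bounds. -/
theorem isGlued_of_isCyclicFlat_iff (hNE : N.E = E) (hk : N.rk E = k)
    (h₁ : ∀ F ⊆ S₁, M₁.IsCyclicFlat (F : Set α) → F.Nonempty → F ≠ S₁ →
      N.rk (F ∪ C₁) = M₁.rk F + #C₁)
    (h₂ : ∀ F ⊆ S₂, M₂.IsCyclicFlat (F : Set α) → F.Nonempty → F ≠ S₂ →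
      N.rk (F ∪ C₂) = M₂.rk F + #C₂)
    (hN : ∀ Z ⊆ E, N.IsCyclicFlat (Z : Set α) →
      (∃ F ⊆ S₁, M₁.IsCyclicFlat (F : Set α) ∧ F.Nonempty ∧ F ≠ S₁ ∧ Z = F ∪ C₁) ∨
      (∃ F ⊆ S₂, M₂.IsCyclicFlat (F : Set α) ∧ F.Nonempty ∧ F ≠ S₂ ∧ Z = F ∪ C₂) ∨
      Z = ∅ ∨ Z = E) : IsGlued M₁ M₂ C₁ U₁ C₂ U₂ E k N := by
  refine ⟨hNE, fun A hA ↦ ?_⟩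
  have b1 := rk_le_liftRk h.split₁ hNE hk.le h₁ hA
  have b2 := rk_le_liftRk h.split₂ hNE hk.le h₂ hA
  have b3 := N.rk_le_card A
  have b4 := hk ▸ rk_le_rk_ground hNE A
  have key : ∀ {M : Matroid α} {S C U F : Finset α}, IsSplit M S C U E k → F ⊆ S →
      N.rk (F ∪ C) = M.rk F + #C → N.rk A = N.rk (F ∪ C) + #(A \ (F ∪ C)) →
      liftRk M C U A ≤ N.rk A := by
    intro M S C U F hs hFS hF hA'
    have h1 := M.rk_le_rk_add_card_sdiff (A ∩ S) F
    rw [rk_inter_ground hs.ground] at h1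
    rw [hs.card_sdiff_eq hA hFS] at hA'
    simp only [liftRk]
    omega
  have hmem : #A ≤ N.rk A ∨ k ≤ N.rk A ∨ liftRk M₁ C₁ U₁ A ≤ N.rk A ∨
      liftRk M₂ C₂ U₂ A ≤ N.rk A := by
    obtain ⟨Z, hZE, hZ, hZr⟩ := exists_isCyclicFlat_rk_eq hNE A
    rw [inter_eq_left.2 hA] at hZr
    obtain ⟨F, hF, hFc, hne, hp, rfl⟩ | ⟨F, hF, hFc, hne, hp, rfl⟩ | rfl | rfl := hN Z hZE hZ
    · exact .inr (.inr (.inl (key h.split₁ hF (h₁ F hF hFc hne hp) hZr)))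
    · exact .inr (.inr (.inr (key h.split₂ hF (h₂ F hF hFc hne hp) hZr)))
    · rw [sdiff_empty] at hZr
      exact .inl (by omega)
    · exact .inr (.inl (by omega))
  have hs := glueRk_spec (M₁ := M₁) (M₂ := M₂) (C₁ := C₁) (U₁ := U₁) (C₂ := C₂) (U₂ := U₂) (k := k)
    (A := A)
  omega

end IsGluing

end Glue

/-! ### Minors in normal form, and isomorphisms as maps that preserve rank -/

section Minor

variable {α : Type*} [DecidableEq α] {M N : Matroid α} {A B C D E X Y : Finset α} {e : α}

lemma rk_dual_add (hE : M.E = E) (hA : A ⊆ E) :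
    M✶.rk A + M.rk E = M.rk (E \ A) + #A := by
  rw [← Nat.cast_inj (R := ℕ∞)]
  push_cast [coe_rk]
  rw [← hE, eRk_ground, eRk_dual_add_eRank _ _ (by rw [hE]; exact_mod_cast hA),
    Set.encard_coe_eq_coe_finsetCard]

lemma rk_delete (hX : Disjoint X D) : (M ＼ (D : Set α)).rk X = M.rk X := by
  rw [rk_eq_rk_iff, delete_eq_restrict, restrict_eRk_eq', ← M.eRk_inter_ground X]
  congr 1
  ext x
  have := fun h : x ∈ X ↦ disjoint_left.1 hX h
  simp
  tauto

lemma rk_contract_add (hE : M.E = E) (hC : C ⊆ E) (hX : X ⊆ E) (hXC : Disjoint X C) :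
    (M ／ (C : Set α)).rk X + M.rk C = M.rk (X ∪ C) := by
  have hE' : (M✶ ＼ (C : Set α)).E = ((E \ C : Finset α) : Set α) := by simp [hE]
  have hXE : X ⊆ E \ C := subset_sdiff.2 ⟨hX, hXC⟩
  have h1 := rk_dual_add hE' hXE
  rw [dual_delete_dual, rk_delete sdiff_disjoint, rk_delete (sdiff_disjoint.mono_left sdiff_subset)]
    at h1
  have h2 := rk_dual_add hE (sdiff_subset (s := E) (t := C))
  have h3 := rk_dual_add hE ((sdiff_subset (s := E \ C) (t := X)).trans sdiff_subset)
  rw [Finset.sdiff_sdiff_eq_self hC] at h2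
  have h4 : E \ ((E \ C) \ X) = X ∪ C := by
    ext x
    have := @hC x
    have := @hX x
    simp
    tauto
  rw [h4] at h3
  have h5 := card_sdiff_add_card_eq_card hXE
  omega

/-- `W` is a basis of `B` relative to `A`. It supplies both a basis of the contracted set and the
elements that make a minor's representation spanning. -/
lemma exists_rk_union_eq (M : Matroid α) (hAB : A ⊆ B) :
    ∃ W ⊆ B, Disjoint A W ∧ M.rk (A ∪ W) = M.rk B ∧ M.rk A + #W = M.rk B := by
  have hne : {W ∈ B.powerset | Disjoint A W ∧ M.rk A + #W ≤ M.rk (A ∪ W)}.Nonempty :=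
    ⟨∅, by simp⟩
  obtain ⟨W, hW, hmax⟩ := exists_max_image _ card hne
  simp only [mem_filter, mem_powerset] at hW hmax
  obtain ⟨hWB, hd, hr⟩ := hW
  have hABW : A ∪ W ∪ B = B := union_eq_right.2 (union_subset hAB hWB)
  have h1 : M.rk (A ∪ W ∪ B) = M.rk (A ∪ W) := by
    refine rankFn_union_eq (E := B) (fun _ _ h _ ↦ M.rk_mono h) (fun _ _ _ _ ↦ M.rk_submod _ _)
      (union_subset hAB hWB) subset_rfl fun e he ↦ ?_
    by_contra! hlt
    have heAW : e ∉ A ∪ W := fun h' ↦ by simp [insert_eq_of_mem h'] at hlt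
    simp only [mem_union, not_or] at heAW
    have h2 := hmax (insert e W) ⟨insert_subset he hWB, by simp [heAW.1, hd], ?_⟩
    · rw [card_insert_of_notMem heAW.2] at h2
      omega
    · rw [card_insert_of_notMem heAW.2, union_insert]
      omega
  rw [hABW] at h1
  have h3 := M.rk_union_le A W
  have h4 := M.rk_le_card W
  exact ⟨W, hWB, hd, h1.symm, by omega⟩

/-- `N` is the minor on `A` that arises from `M` by contracting the independent set `Y` and
deleting a coindependent set. -/
structure IsMinorRep (M : Matroid α) (E A Y : Finset α) (N : Matroid α) : Prop where
  ground : N.E = A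
  subset : A ⊆ E
  subset_Y : Y ⊆ E
  disjoint : Disjoint A Y
  rk_Y : M.rk Y = #Y
  rk_union : M.rk (A ∪ Y) = M.rk E
  rk_add : ∀ X ⊆ A, N.rk X + #Y = M.rk (X ∪ Y)

lemma rk_contract_delete (hE : M.E = E) (hC : C ⊆ E) (hX : X ⊆ E) (hXC : Disjoint X C)
    (hXD : Disjoint X D) :
    (M ／ (C : Set α) ＼ (D : Set α)).rk X + M.rk C = M.rk (X ∪ C) := by
  rw [rk_delete hXD, rk_contract_add hE hC hX hXC]

/-- Contracting `C` has the same effect on ranks as contracting a basis `Y` of `C`. Elements `W`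
that are independent over `A ∪ Y` may be contracted instead of deleted without changing ranks within
`A`; with a maximal such `W` the set `A ∪ Y ∪ W` spans. -/
theorem IsMinor.exists_isMinorRep (h : N ≤m M) (hE : M.E = E) :
    ∃ A Y, IsMinorRep M E A Y N := by
  obtain ⟨C, D, hC, hD, hCD, rfl⟩ := h.exists_eq_contract_delete_disjoint
  rw [hE] at hC hD
  lift C to Finset α using E.finite_toSet.subset hC
  lift D to Finset α using E.finite_toSet.subset hD
  rw [coe_subset] at hC hD
  have hcon : ∀ X ⊆ (E \ C) \ D, (M ／ (C : Set α) ＼ (D : Set α)).rk X + M.rk C = M.rk (X ∪ C) := by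
    intro X hX
    rw [subset_sdiff, subset_sdiff] at hX
    exact rk_contract_delete hE hC hX.1.1 hX.1.2 hX.2
  obtain ⟨Y, hY, -, hYr, hYc⟩ := M.exists_rk_union_eq (empty_subset C)
  rw [empty_union] at hYr
  rw [rk_empty, zero_add] at hYc
  have hAE : (E \ C) \ D ⊆ E := sdiff_subset.trans sdiff_subset
  have hsup : ∀ X, M.rk (X ∪ C) = M.rk (X ∪ Y) := by
    intro X
    have h1 := M.rk_submod (X ∪ Y) C
    have h2 : M.rk Y ≤ M.rk ((X ∪ Y) ∩ C) := M.rk_mono (subset_inter subset_union_right hY)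
    have h3 : M.rk (X ∪ C) ≤ M.rk (X ∪ Y ∪ C) :=
      M.rk_mono (union_subset_union subset_union_left subset_rfl)
    have h4 : M.rk (X ∪ Y) ≤ M.rk (X ∪ C) := M.rk_mono (union_subset_union subset_rfl hY)
    omega
  obtain ⟨W, hW, hdW, hWr, hWc⟩ := M.exists_rk_union_eq
    (union_subset hAE (hY.trans hC))
  rw [disjoint_union_left] at hdW
  have hcard : #(Y ∪ W) = #Y + #W := card_union_of_disjoint hdW.2
  have hXYW : ∀ X ⊆ (E \ C) \ D, M.rk (X ∪ (Y ∪ W)) = M.rk (X ∪ Y) + #W := by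
    intro X hX
    have h1 := M.rk_submod (X ∪ (Y ∪ W)) ((E \ C) \ D ∪ Y)
    have h2 : M.rk (X ∪ Y) ≤ M.rk ((X ∪ (Y ∪ W)) ∩ ((E \ C) \ D ∪ Y)) :=
      M.rk_mono (subset_inter (union_subset_union subset_rfl subset_union_left)
        (union_subset_union hX subset_rfl))
    have h3 : M.rk ((E \ C) \ D ∪ Y ∪ W) ≤ M.rk (X ∪ (Y ∪ W) ∪ ((E \ C) \ D ∪ Y)) :=
      M.rk_mono fun x ↦ by simp; tauto
    have h4 := M.rk_union_le (X ∪ Y) W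
    rw [union_assoc] at h4
    have h5 := M.rk_le_card W
    omega
  refine ⟨(E \ C) \ D, Y ∪ W, by simp [hE], hAE, union_subset (hY.trans hC) hW, ?_, ?_, ?_, ?_⟩
  · rw [disjoint_union_right]
    exact ⟨(sdiff_disjoint.mono_left sdiff_subset).mono_right hY, hdW.1⟩
  · have h1 := hXYW ∅ (empty_subset _)
    rw [empty_union, empty_union] at h1
    omega
  · rw [← union_assoc, hWr]
  · intro X hX
    have h1 := hXYW X hX
    have h2 := hcon X hX
    rw [hsup] at h2
    omega

lemma isMinorRep_contract_delete (hE : M.E = E) (hA : A ⊆ E) (hY : Y ⊆ E) (hAY : Disjoint A Y)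
    (hYr : M.rk Y = #Y) (hr : M.rk (A ∪ Y) = M.rk E) :
    IsMinorRep M E A Y (M ／ (Y : Set α) ＼ ((E \ (A ∪ Y) : Finset α) : Set α)) where
  ground := by
    rw [delete_ground, contract_ground, hE, ← coe_sdiff, ← coe_sdiff, coe_inj]
    ext x
    have := @hA x
    have := fun h : x ∈ A ↦ disjoint_left.1 hAY h
    simp
    tauto
  subset := hA
  subset_Y := hY
  disjoint := hAY
  rk_Y := hYr
  rk_union := hr
  rk_add X hX := by
    rw [← hYr]
    exact rk_contract_delete hE hY (hX.trans hA) (hAY.mono_left hX)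
      ((disjoint_sdiff.mono_left subset_union_left).mono_left hX)

/-- A minor of `M ＼ {e}` is a minor of `M` with the same contracted set. -/
lemma IsMinorRep.of_delete (h : IsMinorRep (M ＼ {e}) (E.erase e) A Y N)
    (he : M.rk E ≤ M.rk (E.erase e)) : IsMinorRep M E A Y N := by
  have hd : ∀ X ⊆ E.erase e, (M ＼ {e}).rk X = M.rk X := by
    intro X hX
    rw [← coe_singleton, rk_delete]
    rw [disjoint_singleton_right]
    exact fun h ↦ (mem_erase.1 (hX h)).1 rfl
  refine ⟨h.ground, h.subset.trans (erase_subset _ _), h.subset_Y.trans (erase_subset _ _),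
    h.disjoint, ?_, ?_, fun X hX ↦ ?_⟩
  · rw [← hd _ h.subset_Y, h.rk_Y]
  · rw [← hd _ (union_subset h.subset h.subset_Y), h.rk_union, hd _ subset_rfl]
    exact (M.rk_mono (erase_subset _ _)).antisymm he
  · rw [h.rk_add X hX, hd _ (union_subset (hX.trans h.subset) h.subset_Y)]

/-- A minor of `M ／ {e}` is a minor of `M` that arises by contracting `e` as well. -/
lemma IsMinorRep.of_contract (hE : M.E = E) (heE : e ∈ E)
    (h : IsMinorRep (M ／ {e}) (E.erase e) A Y N) (he : M.rk {e} = 1) :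
    IsMinorRep M E A (insert e Y) N := by
  have heY : e ∉ Y := fun h' ↦ (mem_erase.1 (h.subset_Y h')).1 rfl
  have heA : e ∉ A := fun h' ↦ (mem_erase.1 (h.subset h')).1 rfl
  have hd : ∀ X ⊆ E.erase e, (M ／ {e}).rk X + 1 = M.rk (insert e X) := by
    intro X hX
    rw [← coe_singleton, ← he, rk_contract_add hE (singleton_subset_iff.2 heE)
      (hX.trans (erase_subset _ _)), union_comm, ← insert_eq]
    rw [disjoint_singleton_right]
    exact fun h ↦ (mem_erase.1 (hX h)).1 rfl
  refine ⟨h.ground, h.subset.trans (erase_subset _ _),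
    insert_subset heE (h.subset_Y.trans (erase_subset _ _)), ?_, ?_, ?_, fun X hX ↦ ?_⟩
  · simp [heA, h.disjoint]
  · rw [← hd _ h.subset_Y, h.rk_Y, card_insert_of_notMem heY]
  · rw [union_insert, ← hd _ (union_subset h.subset h.subset_Y), h.rk_union, hd _ subset_rfl,
      insert_erase heE]
  · rw [union_insert, ← hd _ (union_subset (hX.trans h.subset) h.subset_Y), ← h.rk_add X hX,
      card_insert_of_notMem heY, add_assoc]

/-! ### Isomorphism and rank -/

/-- Replaces a bijection between subtypes by a map on `α`, so that finite sets can be transported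
with `Finset.image`. -/
lemma Isomorphic.exists_image (h : M.Isomorphic N) (hM : M.E = A) (hN : N.E = B) :
    ∃ φ : α → α, Set.InjOn φ A ∧ A.image φ = B ∧ ∀ X ⊆ A, N.rk (X.image φ) = M.rk X := by
  classical
  obtain ⟨f, hf⟩ := h
  let φ : α → α := fun x ↦ if hx : x ∈ M.E then f ⟨x, hx⟩ else x
  have hφ : ∀ x (hx : x ∈ M.E), φ x = f ⟨x, hx⟩ := fun x hx ↦ by simp [φ, hx]
  have hinj : Set.InjOn φ M.E := by
    intro x hx y hy hxy
    rw [hφ x hx, hφ y hy, Subtype.val_inj, f.injective.eq_iff] at hxy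
    exact congrArg Subtype.val hxy
  have himg : ∀ I : Set M.E, φ '' (Subtype.val '' I) = Subtype.val '' (f '' I) := by
    intro I
    rw [Set.image_image, Set.image_image]
    exact Set.image_congr fun x _ ↦ hφ x x.2
  have hmap : M.map φ hinj = N := by
    have hE : φ '' M.E = N.E := by
      have := himg Set.univ
      simpa [Set.image_univ, f.surjective.range_eq] using this
    refine ext_indep hE fun J hJ ↦ ?_
    rw [map_ground, Set.subset_image_iff] at hJ
    obtain ⟨I, hI, rfl⟩ := hJ
    rw [map_image_indep_iff hI]
    have := hf (Subtype.val ⁻¹' I)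
    rw [← himg, Subtype.image_preimage_coe, Set.inter_eq_right.2 hI] at this
    exact this
  refine ⟨φ, hM ▸ hinj, ?_, fun X hX ↦ ?_⟩
  · rw [← coe_inj, coe_image, ← hM, ← hN, ← hmap, map_ground]
  · have hX' : (X : Set α) ⊆ M.E := by
      rw [hM]
      exact_mod_cast hX
    rw [rk_eq_rk_iff, coe_image, ← hmap, M.eRk_map hinj hX']

lemma isIsomorphism_of_image {φ : α → α} (hφ : Set.BijOn φ M.E N.E) (hM : M.E = A)
    (h : ∀ X ⊆ A, N.rk (X.image φ) = M.rk X) : M.IsIsomorphism N (hφ.equiv φ) := by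
  intro I
  have himg : Subtype.val '' (hφ.equiv φ '' I) = φ '' (Subtype.val '' I) := by
    rw [Set.image_image, Set.image_image]
    rfl
  have hI : Subtype.val '' I ⊆ M.E := by simp
  rw [himg]
  generalize (Subtype.val '' I : Set α) = J at hI
  rw [hM] at hI
  lift J to Finset α using A.finite_toSet.subset hI
  rw [coe_subset] at hI
  rw [← coe_image, indep_coe_iff, indep_coe_iff, h J hI, card_image_of_injOn]
  exact hφ.injOn.mono (by rw [hM]; exact_mod_cast hI)

lemma isomorphic_of_image {φ : α → α} (hM : M.E = A) (hN : N.E = B) (hinj : Set.InjOn φ A)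
    (himg : A.image φ = B) (h : ∀ X ⊆ A, N.rk (X.image φ) = M.rk X) : M.Isomorphic N := by
  have hφ : Set.BijOn φ M.E N.E := by
    rw [hM, hN, ← himg, coe_image]
    exact hinj.bijOn_image
  exact ⟨_, isIsomorphism_of_image hφ hM h⟩

end Minor

/-! ### Rank functions of free extensions and free coextensions -/

section FreeExtension

variable {α : Type*} {M N : Matroid α} {A B C E S U : Finset α} {x : α} {k : ℕ}

lemma isBase_coe_iff (hE : N.E = E) :
    N.IsBase (B : Set α) ↔ N.rk B = #B ∧ #B = N.rk E := by
  constructor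
  · intro h
    have h1 := indep_coe_iff.1 h.indep
    refine ⟨h1, ?_⟩
    rw [← h1, rk_eq_iff, h.eRk_eq_eRank, eRank_eq_rk hE]
  · rintro ⟨h1, h2⟩
    refine (indep_coe_iff.2 h1).isBase_of_eRk_ge B.finite_toSet ?_
    rw [eRank_eq_rk hE, ← h2, ← h1, coe_rk]

variable [DecidableEq α]

/-- The free extension exists, and its rank function is as expected. -/
theorem exists_isFreeExtension (hE : N.E = E) (hx : x ∉ E) :
    ∃ N', IsFreeExtension N x N' ∧ N'.E = ((insert x E : Finset α) : Set α) ∧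
      (∀ A ⊆ E, N'.rk A = N.rk A) ∧
      ∀ A ⊆ E, N'.rk (insert x A) = min (N.rk E) (N.rk A + 1) := by
  have hs : IsSplit N E ∅ {x} (insert x E) (N.rk E) :=
    ⟨hE, by ext; simp, by simp, by simpa using hx, by simp, by simp⟩
  -- The candidate makes `x` a coloop and then truncates to the rank of `N`.
  obtain ⟨N', hN'E, hN'⟩ : ∃ N' : Matroid α, N'.E = ((insert x E : Finset α) : Set α) ∧
      ∀ A ⊆ insert x E, N'.rk A = min (N.rk E) (liftRk N ∅ {x} A) := by
    refine exists_matroid_of_rankFn (insert x E) _ (fun A _ ↦ ?_)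
      (fun A B hAB _ ↦ min_le_min le_rfl (IsSplit.liftRk_mono hAB)) (fun A B _ _ ↦ ?_)
    · have h1 := hs.liftRk_le_add A ∅
      simp only [liftRk, rk_empty, card_empty, empty_inter, sdiff_empty] at h1 ⊢
      omega
    · have h1 := IsSplit.liftRk_submod (M := N) (C := ∅) (U := {x}) A B
      have h2 := IsSplit.liftRk_mono (M := N) (C := ∅) (U := {x}) (inter_subset_left (s₁ := A) (s₂ := B))
      have h3 := IsSplit.liftRk_mono (M := N) (C := ∅) (U := {x}) (inter_subset_right (s₁ := A) (s₂ := B))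
      omega
  have hr : ∀ A ⊆ E, N'.rk A = N.rk A := by
    intro A hA
    rw [hN' A (hA.trans (subset_insert _ _)), liftRk, inter_singleton_of_notMem (fun h ↦ hx (hA h))]
    have := rk_le_rk_ground hE A
    simp
    omega
  have hrx : ∀ A ⊆ E, N'.rk (insert x A) = min (N.rk E) (N.rk A + 1) := by
    intro A hA
    rw [hN' _ (insert_subset_insert _ hA), hs.liftRk_insert_of_mem_U (mem_singleton_self x)
      (fun h ↦ hx (hA h)), liftRk, inter_singleton_of_notMem (fun h ↦ hx (hA h))]
    simp
  refine ⟨N', ⟨by rw [hE]; exact_mod_cast hx, by rw [hN'E, hE]; simp, fun C ↦ ?_⟩, hN'E, hr, hrx⟩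
  have hdel : N' ＼ {x} = N := by
    refine ext_rk (E := E) ?_ hE fun A hA ↦ ?_
    · rw [delete_ground, hN'E]
      simp [hx]
    · rw [← coe_singleton, rk_delete, hr A hA]
      simpa using fun h ↦ hx (hA h)
  by_cases hxC : x ∈ C
  · have hnot : ¬ N.IsCircuit C := fun h ↦ hx <| by
      have := h.subset_ground hxC
      rw [hE] at this
      exact_mod_cast this
    rw [or_iff_right hnot]
    -- Adding `x` keeps a set independent exactly when the set is independent and not a base; hence
    -- the circuits through `x` are the bases with `x` added.
    have hind : ∀ I ⊆ E, (N'.Indep ((insert x I : Finset α) : Set α) ↔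
        N.rk I = #I ∧ #I < N.rk E) := by
      intro I hI
      rw [indep_coe_iff, hrx I hI, card_insert_of_notMem fun h ↦ hx (hI h)]
      have := N.rk_le_card I
      omega
    constructor
    · intro hC
      have hCE := hC.subset_ground
      rw [hN'E] at hCE
      lift C to Finset α using (insert x E).finite_toSet.subset hCE
      have hBE : C.erase x ⊆ E := by
        rw [coe_subset] at hCE
        intro y hy
        have := hCE (mem_of_mem_erase hy)
        simp only [mem_erase, mem_insert] at this hy
        tauto
      have hCx : insert x (C.erase x) = C := insert_erase (by exact_mod_cast hxC)
      refine ⟨(C.erase x : Finset α), ?_, by rw [← coe_insert, hCx]⟩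
      have h1 := hC.sdiff_singleton_indep hxC
      rw [← coe_erase, indep_coe_iff, hr _ hBE] at h1
      have h2 := hind _ hBE
      rw [hCx, iff_false_left hC.not_indep] at h2
      have h3 := rk_le_rk_ground hE (C.erase x)
      rw [isBase_coe_iff hE]
      omega
    · rintro ⟨B, hB, rfl⟩
      have hBE := hB.subset_ground
      rw [hE] at hBE
      lift B to Finset α using E.finite_toSet.subset hBE
      rw [coe_subset] at hBE
      rw [isBase_coe_iff hE] at hB
      have hxB : x ∉ B := fun h ↦ hx (hBE h)
      rw [isCircuit_iff_dep_forall_sdiff_singleton_indep]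
      refine ⟨⟨?_, ?_⟩, ?_⟩
      · rw [← coe_insert, hind B hBE]
        omega
      · rw [hN'E, ← coe_insert, coe_subset]
        exact insert_subset_insert _ hBE
      · intro e he
        rw [← coe_insert, mem_coe, mem_insert] at he
        rw [← coe_insert, ← coe_erase]
        obtain rfl | he := he
        · rw [erase_insert hxB, indep_coe_iff, hr B hBE, hB.1]
        · have hne : e ≠ x := fun h ↦ hxB (h ▸ he)
          rw [erase_insert_of_ne hne.symm, hind _ ((erase_subset _ _).trans hBE)]
          have h1 := card_erase_add_one he
          have h2 := N.rk_le_rk_erase e B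
          have h3 := N.rk_le_card (B.erase e)
          omega
  · have h1 : N.IsCircuit C ↔ N'.IsCircuit C := by
      rw [← hdel, delete_isCircuit_iff]
      simp [hxC]
    rw [h1]
    refine ⟨.inl, fun h ↦ h.elim id ?_⟩
    rintro ⟨B, hB, rfl⟩
    exact absurd (Set.mem_insert x B) hxC

/-- The free coextension exists, and its rank function is as expected. -/
theorem exists_isFreeCoextension (hE : N.E = E) (hx : x ∉ E) :
    ∃ N', IsFreeCoextension N x N' ∧ N'.E = ((insert x E : Finset α) : Set α) ∧
      (∀ A ⊆ E, N'.rk A = min #A (N.rk A + 1)) ∧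
      ∀ A ⊆ E, N'.rk (insert x A) = N.rk A + 1 := by
  -- All ranks are read off from the free extension of the dual through the formula for the dual
  -- rank.
  obtain ⟨K, hK, hKE, hKr, hKx⟩ := exists_isFreeExtension (N := N✶) (E := E) hE hx
  have hKtop := hKx E subset_rfl
  have hdE := rk_dual_add hE (subset_refl E)
  rw [sdiff_self, bot_eq_empty, rk_empty] at hdE
  refine ⟨K✶, by rwa [IsFreeCoextension, dual_dual], hKE, fun A hA ↦ ?_, fun A hA ↦ ?_⟩
  · have hxA : x ∉ A := fun h ↦ hx (hA h)
    have h1 := rk_dual_add hKE (hA.trans (subset_insert x E))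
    rw [insert_sdiff_of_notMem _ hxA, hKx _ sdiff_subset] at h1
    have h2 := rk_dual_add hE (sdiff_subset (s := E) (t := A))
    rw [Finset.sdiff_sdiff_eq_self hA] at h2
    have h3 := card_sdiff_add_card_eq_card hA
    omega
  · have hxA : x ∉ A := fun h ↦ hx (hA h)
    have h1 := rk_dual_add hKE (insert_subset_insert x hA)
    have h4 : insert x E \ insert x A = E \ A := by
      ext y
      have : y = x → y ∉ E := by rintro rfl; exact hx
      simp
      tauto
    rw [h4, hKr _ sdiff_subset, card_insert_of_notMem hxA] at h1
    have h2 := rk_dual_add hE (sdiff_subset (s := E) (t := A))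
    rw [Finset.sdiff_sdiff_eq_self hA] at h2
    have h3 := card_sdiff_add_card_eq_card hA
    omega

/-- A matroid obtained from `M` by repeated free coextension by `C`. -/
lemma exists_obtainable_coextension (hM : M.E = S) (hSC : Disjoint S C) :
    ∃ Q, M.Obtainable Q ∧ Q.E = ((S ∪ C : Finset α) : Set α) ∧
      ∀ A ⊆ S ∪ C, Q.rk A = min #A (M.rk A + #C) := by
  induction C using Finset.induction_on with
  | empty =>
    refine ⟨M, .refl, by simpa using hM, fun A _ ↦ ?_⟩
    have := M.rk_le_card A
    simp
    omega
  | insert x C hx ih =>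
    rw [disjoint_insert_right] at hSC
    obtain ⟨Q, hQ, hQE, hQr⟩ := ih hSC.2
    have hxE : x ∉ S ∪ C := by simp [hSC.1, hx]
    obtain ⟨Q', hQ', hQ'E, hQ'r, hQ'x⟩ := exists_isFreeCoextension hQE hxE
    refine ⟨Q', hQ.freeCoextension hQ', by rw [hQ'E, union_insert], fun A hA ↦ ?_⟩
    rw [union_insert] at hA
    rw [card_insert_of_notMem hx]
    by_cases hxA : x ∈ A
    · have hA' : A.erase x ⊆ S ∪ C := by rwa [subset_insert_iff] at hA
      have h1 := hQ'x _ hA'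
      rw [insert_erase hxA, hQr _ hA', rk_erase_of_notMem hM hSC.1] at h1
      have h2 := card_erase_add_one hxA
      omega
    · have hA' : A ⊆ S ∪ C := (subset_insert_iff_of_notMem hxA).1 hA
      rw [hQ'r _ hA', hQr _ hA']
      omega

/-- A matroid obtained from `M` by repeated free coextension by `C`, and then repeated free
extension by `U`. -/
theorem exists_obtainable_liftRk (h : IsSplit M S C U E k) :
    ∃ Q, M.Obtainable Q ∧ Q.E = E ∧ ∀ A ⊆ E, Q.rk A = min (min #A k) (liftRk M C U A) := by
  induction U using Finset.induction_on generalizing E with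
  | empty =>
    obtain ⟨Q, hQ, hQE, hQr⟩ := exists_obtainable_coextension h.ground h.disjSC
    have hE : S ∪ C = E := by simpa using h.union
    rw [hE] at hQE hQr
    refine ⟨Q, hQ, hQE, fun A hA ↦ ?_⟩
    have h1 := h.card
    have h2 := h.rk_le A
    rw [hQr A hA, liftRk, inter_empty, card_empty]
    omega
  | insert x U hx ih =>
    have hdSU := h.disjSU
    have hdCU := h.disjCU
    rw [disjoint_insert_right] at hdSU hdCU
    have hs : IsSplit M S C U (S ∪ C ∪ U) k := ⟨h.ground, rfl, h.disjSC, hdSU.2, hdCU.2, h.card⟩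
    obtain ⟨Q, hQ, hQE, hQr⟩ := ih hs
    have hxE : x ∉ S ∪ C ∪ U := by simp [hdSU.1, hdCU.1, hx]
    obtain ⟨Q', hQ', hQ'E, hQ'r, hQ'x⟩ := exists_isFreeExtension hQE hxE
    have hE : insert x (S ∪ C ∪ U) = E := by rw [← h.union, union_insert]
    rw [hE] at hQ'E
    refine ⟨Q', hQ.freeExtension hQ', hQ'E, fun A hA ↦ ?_⟩
    rw [← hE] at hA
    -- The rank is already `k` before `x` is added, so the free extension truncates at that same
    -- level.
    have hk : Q.rk (S ∪ C ∪ U) = k := by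
      rw [hQr _ subset_rfl]
      have h1 := hs.card_E
      have h2 := hs.card
      have h3 := M.rk_mono hs.subset
      have h4 := M.rk_le_card S
      simp only [liftRk]
      omega
    by_cases hxA : x ∈ A
    · have hA' : A.erase x ⊆ S ∪ C ∪ U := by rwa [subset_insert_iff] at hA
      have h1 := hQ'x _ hA'
      have h4 : (A.erase x) ∩ U = A.erase x ∩ insert x U := by
        rw [inter_insert_of_notMem (notMem_erase x A)]
      have h3 := h.liftRk_erase_of_mem_U (mem_insert_self x U) hxA
      rw [liftRk, ← h4, ← liftRk] at h3
      rw [insert_erase hxA, hQr _ hA', hk] at h1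
      have h2 := card_erase_add_one hxA
      omega
    · have hA' : A ⊆ S ∪ C ∪ U := (subset_insert_iff_of_notMem hxA).1 hA
      rw [hQ'r _ hA', hQr _ hA', liftRk, liftRk, inter_insert_of_notMem hxA]

end FreeExtension

/-! ### Rigidity of the two minors, and the intertwine property -/

section Intertwine

variable {α : Type*} {M M₁ M₂ N N' : Matroid α}
  {S C U S₁ C₁ U₁ S₂ C₂ U₂ E A B F Y : Finset α} {k d : ℕ} {e : α}

/-- Reduces minimality to deletions and contractions of a single element. -/
lemma exists_isMinor_delete_or_contract (h : N' <m N) :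
    ∃ e ∈ N.E, N' ≤m N ＼ {e} ∨ N' ≤m N ／ {e} := by
  obtain ⟨e, he, heN'⟩ := Set.exists_of_ssubset h.ssubset
  obtain ⟨C, D, -, -, hCD, rfl⟩ := h.isMinor.exists_eq_contract_delete_disjoint
  refine ⟨e, he, ?_⟩
  by_cases heC : e ∈ C
  · refine .inr ⟨C, D, ?_⟩
    rw [contract_contract, Set.singleton_union, Set.insert_eq_of_mem heC]
  · have heD : e ∈ D := by
      simp only [delete_ground, contract_ground, Set.mem_sdiff] at heN'
      tauto
    refine .inl ⟨C, D, ?_⟩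
    rw [contract_delete_comm _ hCD, contract_delete_comm _ hCD, delete_delete,
      Set.singleton_union, Set.insert_eq_of_mem heD]

variable [DecidableEq α]

/-- The rank form of the condition that no element of `M` and no element of its dual is free or an
isthmus. -/
structure HasNoFree (M : Matroid α) (S : Finset α) : Prop where
  ground : M.E = S
  pos : 0 < M.rk S
  exists_mem : ∀ x ∈ S, ∃ F ⊆ S, x ∈ F ∧ M.rk F ≤ M.rk (F.erase x) ∧ M.rk F < M.rk S
  exists_notMem : ∀ x ∈ S, ∃ F ⊆ S, x ∉ F ∧ M.rk F < M.rk (insert x F) ∧ M.rk F < #F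

lemma exists_mem_of_freeOrIsthmus_eq_empty (hS : M.E = S) (h : M.freeOrIsthmus = ∅) :
    ∀ x ∈ S, ∃ F ⊆ S, x ∈ F ∧ M.rk F ≤ M.rk (F.erase x) ∧ M.rk F < M.rk S := by
  intro x hx
  have hx' : x ∉ M.freeOrIsthmus := by simp [h]
  simp only [freeOrIsthmus, Set.mem_ofPred_eq, not_and, not_forall, not_not, hS, mem_coe] at hx'
  obtain ⟨F, hF, hne, hxF⟩ := hx' hx
  obtain ⟨F, hFS, rfl⟩ := hF.exists_finset hS
  rw [isCyclicFlat_coe_iff hS hFS] at hF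
  refine ⟨F, hFS, hxF, hF.2 x hxF, ?_⟩
  obtain ⟨e, he, heF⟩ := exists_of_ssubset (hFS.ssubset_of_ne (by simpa using hne))
  exact (hF.1 e he heF).trans_le (rk_le_rk_ground hS _)

/-- The second kind of witness is the complement of a proper cyclic flat `G ∋ x` of the dual: `x` is
not a coloop of `G` in the dual, so it is outside the closure of the complement, and `G` does not
span the dual, so the complement is dependent. -/
lemma hasNoFree_of_freeOrIsthmus_eq_empty (hS : M.E = S) (hr : 0 < M.eRank)
    (h : M.freeOrIsthmus = ∅) (h' : M✶.freeOrIsthmus = ∅) : HasNoFree M S := by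
  refine ⟨hS, ?_, exists_mem_of_freeOrIsthmus_eq_empty hS h, fun x hx ↦ ?_⟩
  · rw [eRank_eq_rk hS] at hr
    exact_mod_cast hr
  obtain ⟨G, hGS, hxG, hG, hGr⟩ := exists_mem_of_freeOrIsthmus_eq_empty (M := M✶) hS h' x hx
  have h1 := rk_dual_add hS (subset_refl S)
  rw [sdiff_self, bot_eq_empty, rk_empty] at h1
  have h2 := rk_dual_add hS hGS
  have h3 := rk_dual_add hS ((erase_subset x G).trans hGS)
  have h4 : S \ G.erase x = insert x (S \ G) := by
    ext y
    by_cases y = x <;> simp_all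
  rw [h4] at h3
  have h5 := card_sdiff_add_card_eq_card hGS
  have h6 := card_erase_add_one hxG
  exact ⟨S \ G, sdiff_subset, by simp [hxG], by omega, by omega⟩

namespace HasNoFree

lemma nonempty (h : HasNoFree M S) : S.Nonempty := by
  rw [nonempty_iff_ne_empty]
  rintro rfl
  simpa using h.pos

lemma rk_le_rk_erase_ground (h : HasNoFree M S) : ∀ e ∈ S, M.rk S ≤ M.rk (S.erase e) := by
  intro e he
  obtain ⟨F, hFS, heF, hF, -⟩ := h.exists_mem e he
  have h1 := M.rk_submod F (S.erase e)
  have h2 : F ∩ S.erase e = F.erase e := by rw [inter_erase, inter_eq_left.2 hFS]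
  have h3 : M.rk S ≤ M.rk (F ∪ S.erase e) := M.rk_mono fun x hx ↦ by
    by_cases x = e <;> simp_all
  rw [h2] at h1
  omega

lemma rk_lt_card (h : HasNoFree M S) : M.rk S < #S := by
  obtain ⟨x, hx⟩ := h.nonempty
  obtain ⟨F, hFS, -, -, hF⟩ := h.exists_notMem x hx
  have h1 := M.rk_le_rk_add_card_sdiff S F
  have h2 := card_sdiff_add_card_eq_card hFS
  omega

end HasNoFree

namespace IsGluing

variable (h : IsGluing M₁ M₂ S₁ C₁ U₁ S₂ C₂ U₂ E k d) (hN : IsGlued M₁ M₂ C₁ U₁ C₂ U₂ E k N)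

include h hN

/-- If `M₁` is not obtainable from `M₂`, then the rank bound that comes from `M₂` plays no role in
a minor that is isomorphic to `M₁`. -/
lemma le_liftRk_of_not_obtainable {φ : α → α} (hS : M₁.E = S₁)
    (hob : ¬ ∃ N, M₂.Obtainable N ∧ N.Isomorphic M₁) (hA : A ⊆ E) (hY : Y ⊆ E)
    (hd : Disjoint A Y) (hinj : Set.InjOn φ S₁) (himg : S₁.image φ = A) (hYr : N.rk Y = #Y)
    (hr : N.rk (A ∪ Y) = k) (hX : ∀ X ⊆ S₁, N.rk (X.image φ ∪ Y) = M₁.rk X + #Y) :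
    ∀ X ⊆ S₁, k ≤ liftRk M₂ C₂ U₂ (X.image φ ∪ Y) := by
  have hXA : ∀ X ⊆ S₁, X.image φ ⊆ A := fun X hXS ↦ himg ▸ image_subset_image hXS
  have hXE : ∀ X ⊆ S₁, X.image φ ∪ Y ⊆ E := fun X hXS ↦ union_subset ((hXA X hXS).trans hA) hY
  have hYk : M₁.rk S₁ + #Y = k := by
    rw [← hX S₁ subset_rfl, himg, hr]
  -- If the first lift is below `k` somewhere, the gap inequality applies to two sets that share
  -- `Y`, and `|Y| = k - r(M₁) ≥ d` makes the second lift at least `k` everywhere.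
  by_cases hP : ∃ X ⊆ S₁, liftRk M₁ C₁ U₁ (X.image φ ∪ Y) < k
  · obtain ⟨X₀, hX₀, hlt⟩ := hP
    intro X hXS
    have h1 := h.gap _ (hXE X₀ hX₀) _ (hXE X hXS)
    have h2 : #Y ≤ #((X₀.image φ ∪ Y) ∩ (X.image φ ∪ Y)) :=
      card_le_card (subset_inter subset_union_right subset_union_right)
    have h3 := h.add_le₁
    omega
  -- If it is never below `k`, the ranks in question agree with those in the matroid `Q` obtained
  -- from `M₂`, so `M₁` is isomorphic to a minor of `Q`.
  refine absurd ?_ hob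
  push Not at hP
  obtain ⟨Q, hQ, hQE, hQr⟩ := exists_obtainable_liftRk h.split₂
  have hle : ∀ B ⊆ E, N.rk B ≤ Q.rk B := by
    intro B hB
    have h1 := hN.spec hB
    have h2 := hQr B hB
    omega
  have hQk : ∀ B ⊆ E, Q.rk B ≤ k := by
    intro B hB
    have h2 := hQr B hB
    omega
  have hQA : Q.rk (A ∪ Y) = Q.rk E := by
    have h1 := hle _ (union_subset hA hY)
    have h2 := hQk E subset_rfl
    have h3 := rk_le_rk_ground hQE (A ∪ Y)
    omega
  have hrep := isMinorRep_contract_delete hQE hA hY hd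
    ((Q.rk_le_card Y).antisymm (hYr ▸ hle Y hY)) hQA
  refine ⟨_, hQ.minor (contract_delete_isMinor _ _ _), isomorphic_equivalence.symm
    (isomorphic_of_image hS hrep.ground hinj himg fun X hXS ↦ ?_)⟩
  have h1 := hrep.rk_add _ (hXA X hXS)
  have h2 := hQr _ (hXE X hXS)
  have h3 := hN.spec (hXE X hXS)
  have h4 := hX X hXS
  have h5 := hP X hXS
  omega

/-- Only the first lift, the cardinality and `k` matter on the sets `φ(X) ∪ Y`. A dependent set not
spanning `y` keeps `φ y` out of the loops `C₁`, and a nonspanning set in which `y` is not a coloop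
keeps it out of the coloops `U₁`. So `A = S₁`, and `φ` permutes `S₁`. The map is part of the
statement because the count of isomorphism classes needs that `φ` is an automorphism. -/
theorem image_eq {φ : α → α} (hM₁ : HasNoFree M₁ S₁)
    (hob : ¬ ∃ N, M₂.Obtainable N ∧ N.Isomorphic M₁) (hA : A ⊆ E) (hY : Y ⊆ E)
    (hd : Disjoint A Y) (hinj : Set.InjOn φ S₁) (himg : S₁.image φ = A) (hYr : N.rk Y = #Y)
    (hr : N.rk (A ∪ Y) = k) (hX : ∀ X ⊆ S₁, N.rk (X.image φ ∪ Y) = M₁.rk X + #Y) :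
    A = S₁ ∧ Y = C₁ ∧ ∀ X ⊆ S₁, M₁.rk (X.image φ) = M₁.rk X := by
  have hle := h.le_liftRk_of_not_obtainable hN hM₁.ground hob hA hY hd hinj himg hYr hr hX
  have hs := h.split₁
  have hXA : ∀ X ⊆ S₁, X.image φ ⊆ A := fun X hXS ↦ himg ▸ image_subset_image hXS
  have hXE : ∀ X ⊆ S₁, X.image φ ∪ Y ⊆ E := fun X hXS ↦ union_subset ((hXA X hXS).trans hA) hY
  have hYk : M₁.rk S₁ + #Y = k := by
    rw [← hX S₁ subset_rfl, himg, hr]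
  have hcX : ∀ X ⊆ S₁, #(X.image φ) = #X := fun X hXS ↦
    card_image_of_injOn (hinj.mono (by exact_mod_cast hXS))
  have hcard : ∀ X ⊆ S₁, #(X.image φ ∪ Y) = #X + #Y := fun X hXS ↦ by
    rw [card_union_of_disjoint (hd.mono_left (hXA X hXS)), hcX X hXS]
  have hAS : A ⊆ S₁ := by
    intro x hx
    rw [← himg, mem_image] at hx
    obtain ⟨y, hy, rfl⟩ := hx
    have hyA : φ y ∈ A := hXA S₁ subset_rfl (mem_image_of_mem φ hy)
    have hyY : φ y ∉ Y := disjoint_left.1 hd hyA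
    obtain h' | h' | h' := hs.mem_cases (hA hyA)
    · exact h'
    · obtain ⟨F, hF, hyF, hFr, hFc⟩ := hM₁.exists_notMem y hy
      have hF' := insert_subset hy hF
      have h1 := hN.spec (hXE F hF)
      have h2 := hN.spec (hXE _ hF')
      have h3 := hle F hF
      have h4 := hcard F hF
      have h5 := hX F hF
      have h6 := hX _ hF'
      have h7 := hs.rk_le (insert y F)
      rw [image_insert, insert_union] at h2 h6
      rw [hs.liftRk_insert_of_mem_C h'] at h2
      omega
    · obtain ⟨F, hF, hyF, hFr, hFc⟩ := hM₁.exists_mem y hy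
      have hF' := (erase_subset y F).trans hF
      have h1 := hN.spec (hXE F hF)
      have h2 := hN.spec (hXE _ hF')
      have h3 := hle F hF
      have h4 := hcard F hF
      have h5 := hX F hF
      have h6 := hX _ hF'
      have h7 := M₁.rk_le_card (F.erase y)
      have h8 := card_erase_add_one hyF
      have h9 : (F.erase y).image φ ∪ Y = (F.image φ ∪ Y).erase (φ y) := by
        rw [erase_union_distrib, erase_eq_of_notMem hyY]
        congr 1
        ext z
        simp only [mem_image, mem_erase]
        constructor
        · rintro ⟨w, ⟨hwy, hw⟩, rfl⟩
          exact ⟨fun h ↦ hwy (hinj (hF hw) hy h), w, hw, rfl⟩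
        · rintro ⟨hz, w, hw, rfl⟩
          exact ⟨w, ⟨fun h ↦ hz (by rw [h]), hw⟩, rfl⟩
      have h10 := hs.liftRk_erase_of_mem_U h'
        (mem_union_left Y (mem_image_of_mem φ hyF))
      rw [h9] at h2 h6
      omega
  have hA' : A = S₁ := eq_of_subset_of_card_le hAS (by rw [← himg, hcX S₁ subset_rfl])
  rw [hA'] at himg hd
  -- After subtracting `|Y| = |C₁|`, the rank of `X` is the minimum of `|X|`, `r(M₁)` and the rank
  -- of `φ(X)` plus `|Y ∩ U₁|`.
  have hform : ∀ X ⊆ S₁, M₁.rk (X.image φ) ≤ M₁.rk X ∧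
      (M₁.rk X = #X ∨ M₁.rk X = M₁.rk S₁ ∨ M₁.rk X = M₁.rk (X.image φ) + #(Y ∩ U₁)) := by
    intro X hXS
    have hφX : X.image φ ⊆ S₁ := himg ▸ image_subset_image hXS
    have h1 := hN.spec (hXE X hXS)
    have h2 := hX X hXS
    have h3 := hle X hXS
    have h4 := hcard X hXS
    have h5 := hs.card
    have h6 := M₁.rk_le_card (X.image φ)
    have h7 := hcX X hXS
    have h8 := hs.rk_le (X.image φ)
    have h9 : M₁.rk (X.image φ ∪ Y) = M₁.rk (X.image φ) := hs.rk_congr fun x hx ↦ by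
      simp [disjoint_left.1 hd hx]
    have h10 : (X.image φ ∪ Y) ∩ U₁ = Y ∩ U₁ := by
      rw [union_inter_distrib_right, disjoint_iff_inter_eq_empty.1 (hs.disjSU.mono_left hφX),
        empty_union]
    have h11 : liftRk M₁ C₁ U₁ (X.image φ ∪ Y) = M₁.rk (X.image φ) + #C₁ + #(Y ∩ U₁) := by
      rw [liftRk, h9, h10]
    omega
  -- `φ` permutes the subsets of `S₁`, so both sides have equal sums; the termwise inequality is
  -- then an equality.
  have hsum : ∑ X ∈ S₁.powerset, M₁.rk (X.image φ) = ∑ X ∈ S₁.powerset, M₁.rk X := by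
    refine sum_nbij (fun X ↦ X.image φ) ?_ ?_ ?_ fun _ _ ↦ rfl
    · intro X hX
      rw [mem_powerset] at hX ⊢
      exact himg ▸ image_subset_image hX
    · intro X hX X' hX' heq
      simp only [coe_powerset, Set.mem_preimage, Set.mem_powerset_iff, coe_subset] at hX hX'
      rw [← coe_inj, ← hinj.image_eq_image_iff (by exact_mod_cast hX) (by exact_mod_cast hX')]
      exact_mod_cast heq
    · intro X hX
      simp only [coe_powerset, Set.mem_preimage, Set.mem_powerset_iff, coe_subset] at hX
      rw [← himg] at hX
      obtain ⟨X', hX', rfl⟩ := Finset.subset_image_iff.1 hX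
      exact ⟨X', by simpa using hX', rfl⟩
  have heq : ∀ X ⊆ S₁, M₁.rk (X.image φ) = M₁.rk X := by
    have := (sum_eq_sum_iff_of_le fun X hX ↦ (hform X (mem_powerset.1 hX)).1).1 hsum
    exact fun X hX ↦ this X (mem_powerset.2 hX)
  refine ⟨hA', ?_, heq⟩
  obtain ⟨y, hy⟩ := hM₁.nonempty
  -- A dependent nonspanning set leaves only the third alternative of `hform`, which forces `Y ∩ U₁`
  -- to be empty.
  obtain ⟨F, hF, -, hFr, hFc⟩ := hM₁.exists_notMem y hy
  have hFr' := hs.rk_le (insert y F)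
  have hF' := hF
  rw [← himg] at hF'
  obtain ⟨X, hXS, rfl⟩ := Finset.subset_image_iff.1 hF'
  have h1 := hform X hXS
  have h2 := heq X hXS
  have h3 := hcX X hXS
  have h4 : #(Y ∩ U₁) = 0 := by omega
  rw [card_eq_zero, ← disjoint_iff_inter_eq_empty] at h4
  refine eq_of_subset_of_card_le (fun x hx ↦ ?_) ?_
  · obtain h' | h' | h' := hs.mem_cases (hY hx)
    · exact absurd hx (disjoint_left.1 hd h')
    · exact h'
    · exact absurd h' (disjoint_left.1 h4 hx)
  · have := hs.card
    omega

/-- The only minor isomorphic to `M₁` is the one on `S₁` that arises by contracting `C₁`. -/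
theorem eq_of_isMinorRep (hM₁ : HasNoFree M₁ S₁)
    (hob : ¬ ∃ N, M₂.Obtainable N ∧ N.Isomorphic M₁) (hrep : IsMinorRep N E A Y N')
    (hiso : N'.Isomorphic M₁) : A = S₁ ∧ Y = C₁ := by
  obtain ⟨φ, hinj, himg, hφ⟩ :=
    (isomorphic_equivalence.symm hiso).exists_image hM₁.ground hrep.ground
  have hX : ∀ X ⊆ S₁, N.rk (X.image φ ∪ Y) = M₁.rk X + #Y := by
    intro X hX
    rw [← hrep.rk_add _ (himg ▸ image_subset_image hX), hφ X hX]
  obtain ⟨h1, h2, -⟩ := h.image_eq hN hM₁ hob hrep.subset hrep.subset_Y hrep.disjoint hinj himg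
    hrep.rk_Y (hrep.rk_union.trans (h.rk_ground hN)) hX
  exact ⟨h1, h2⟩

lemma hasMinorIso (hM₁ : M₁.E = S₁) : N.HasMinorIso M₁ := by
  have hrC : N.rk C₁ = #C₁ := by
    have := h.rk_union_C hN (empty_subset _)
    rwa [empty_union, rk_empty, zero_add] at this
  have hrS : N.rk (S₁ ∪ C₁) = N.rk E := by
    have := h.split₁.card
    rw [h.rk_union_C hN subset_rfl, h.rk_ground hN]
    omega
  have hrep := isMinorRep_contract_delete hN.ground h.split₁.subset h.split₁.subset_C
    h.split₁.disjSC hrC hrS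
  refine ⟨_, contract_delete_isMinor _ _ _, isomorphic_of_image (φ := id) hrep.ground hM₁
    (Set.injOn_id _) image_id fun X hX ↦ ?_⟩
  have h1 := hrep.rk_add X hX
  rw [h.rk_union_C hN hX] at h1
  rw [image_id]
  omega

/-- By rigidity, minors of `N ＼ {e}` isomorphic to `M₁` and `M₂` put `e` outside all `Sᵢ ∪ Cᵢ`, and
such minors of `N ／ {e}` put `e` in `C₁ ∩ C₂` and outside `S₁ ∪ S₂`. `hC` rules out both. -/
theorem isIntertwine (hM₁ : HasNoFree M₁ S₁) (hM₂ : HasNoFree M₂ S₂)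
    (hob₁ : ¬ ∃ N, M₂.Obtainable N ∧ N.Isomorphic M₁)
    (hob₂ : ¬ ∃ N, M₁.Obtainable N ∧ N.Isomorphic M₂)
    (hC : ∀ e ∈ E, e ∈ S₁ ∨ e ∈ S₂ ∨ (e ∈ C₁ ∧ e ∉ C₂) ∨ (e ∈ C₂ ∧ e ∉ C₁)) :
    N.IsIntertwine M₁ M₂ := by
  refine ⟨⟨h.hasMinorIso hN hM₁.ground, h.symm.hasMinorIso hN.symm hM₂.ground⟩, ?_⟩
  rintro N₀ hN₀ ⟨⟨N₁, hN₁, hi₁⟩, ⟨N₂, hN₂, hi₂⟩⟩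
  obtain ⟨e, he, hN₀e⟩ := exists_isMinor_delete_or_contract hN₀
  rw [hN.ground, mem_coe] at he
  have hEe : (N.E \ {e} : Set α) = ((E.erase e : Finset α) : Set α) := by simp [hN.ground]
  have hempty := h.isCyclicFlat_empty hN hM₁.pos hM₂.pos
  have hground := h.isCyclicFlat_ground hN hM₁.rk_le_rk_erase_ground hM₂.rk_le_rk_erase_ground
    hM₁.rk_lt_card
  rw [isCyclicFlat_coe_iff hN.ground (empty_subset _)] at hempty
  rw [isCyclicFlat_coe_iff hN.ground subset_rfl] at hground
  have hloop : N.rk {e} = 1 := by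
    have h1 := hempty.1 e he (notMem_empty e)
    have h2 := N.rk_le_card {e}
    rw [rk_empty, insert_empty_eq] at h1
    rw [card_singleton] at h2
    omega
  obtain hdel | hcon := hN₀e
  · obtain ⟨A₁, Y₁, hr₁⟩ := (hN₁.trans hdel).exists_isMinorRep hEe
    obtain ⟨A₂, Y₂, hr₂⟩ := (hN₂.trans hdel).exists_isMinorRep hEe
    obtain ⟨rfl, rfl⟩ := h.eq_of_isMinorRep hN hM₁ hob₁ (hr₁.of_delete (hground.2 e he)) hi₁
    obtain ⟨rfl, rfl⟩ := h.symm.eq_of_isMinorRep hN.symm hM₂ hob₂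
      (hr₂.of_delete (hground.2 e he)) hi₂
    have h1 := fun h' ↦ notMem_erase e E (hr₁.subset h')
    have h2 := fun h' ↦ notMem_erase e E (hr₂.subset h')
    have h3 := fun h' ↦ notMem_erase e E (hr₁.subset_Y h')
    have h4 := fun h' ↦ notMem_erase e E (hr₂.subset_Y h')
    have := hC e he
    tauto
  · obtain ⟨A₁, Y₁, hr₁⟩ := (hN₁.trans hcon).exists_isMinorRep hEe
    obtain ⟨A₂, Y₂, hr₂⟩ := (hN₂.trans hcon).exists_isMinorRep hEe
    obtain ⟨rfl, rfl⟩ := h.eq_of_isMinorRep hN hM₁ hob₁ (hr₁.of_contract hN.ground he hloop) hi₁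
    obtain ⟨rfl, rfl⟩ := h.symm.eq_of_isMinorRep hN.symm hM₂ hob₂
      (hr₂.of_contract hN.ground he hloop) hi₂
    have h1 := fun h' ↦ notMem_erase e E (hr₁.subset h')
    have h2 := fun h' ↦ notMem_erase e E (hr₂.subset h')
    have := hC e he
    simp only [mem_insert, true_or, not_true_eq_false, and_false, or_false] at this
    tauto

end IsGluing

end Intertwine

/-! ### Isomorphisms between glued matroids -/

section Isomorphism

variable {α : Type*} [DecidableEq α] {M₁ M₂ N N' : Matroid α}
  {S₁ C₁ U₁ S₂ C₂ U₂ E C₁' U₁' C₂' U₂' E' : Finset α} {k d d' : ℕ} {φ : α → α}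

namespace IsGluing

/-- An isomorphism between two of the constructed matroids respects the parts of the ground set. -/
theorem image_eq_of_isomorphic (h : IsGluing M₁ M₂ S₁ C₁ U₁ S₂ C₂ U₂ E k d)
    (hN : IsGlued M₁ M₂ C₁ U₁ C₂ U₂ E k N) (h' : IsGluing M₁ M₂ S₁ C₁' U₁' S₂ C₂' U₂' E' k d')
    (hN' : IsGlued M₁ M₂ C₁' U₁' C₂' U₂' E' k N') (hM₁ : HasNoFree M₁ S₁)
    (hob : ¬ ∃ N, M₂.Obtainable N ∧ N.Isomorphic M₁) (hinj : Set.InjOn φ E)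
    (himg : E.image φ = E') (hφ : ∀ X ⊆ E, N'.rk (X.image φ) = N.rk X) :
    S₁.image φ = S₁ ∧ C₁.image φ = C₁' ∧ ∀ X ⊆ S₁, M₁.rk (X.image φ) = M₁.rk X := by
  have hS := h.split₁.subset
  have hC := h.split₁.subset_C
  have hcC : #(C₁.image φ) = #C₁ := card_image_of_injOn (hinj.mono (by exact_mod_cast hC))
  have hd : Disjoint (S₁.image φ) (C₁.image φ) := by
    simp only [disjoint_left, mem_image, not_exists, not_and]
    rintro _ ⟨x, hx, rfl⟩ y hy hxy
    rw [hinj (hC hy) (hS hx) hxy] at hy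
    exact disjoint_left.1 h.split₁.disjSC hx hy
  have hX : ∀ X ⊆ S₁, N'.rk (X.image φ ∪ C₁.image φ) = M₁.rk X + #(C₁.image φ) := by
    intro X hX
    rw [← image_union, hφ _ (union_subset (hX.trans hS) hC), h.rk_union_C hN hX, hcC]
  -- The images of `S₁` and `C₁` represent a minor of `N'` isomorphic to `M₁`, so rigidity in `N'`
  -- applies.
  refine h'.image_eq hN' hM₁ hob (himg ▸ image_subset_image hS) (himg ▸ image_subset_image hC) hd
    (hinj.mono (by exact_mod_cast hS)) rfl ?_ ?_ hX
  · have := hX ∅ (empty_subset _)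
    rwa [image_empty, empty_union, rk_empty, zero_add] at this
  · rw [hX S₁ subset_rfl, hcC, add_comm, h.split₁.card]

/-- Such a map preserves both lifts, since `|Cᵢ| = k - r(Mᵢ)` on both sides; hence it preserves
`glueRk`. -/
theorem isomorphic_of_image (h : IsGluing M₁ M₂ S₁ C₁ U₁ S₂ C₂ U₂ E k d)
    (hN : IsGlued M₁ M₂ C₁ U₁ C₂ U₂ E k N) (h' : IsGluing M₁ M₂ S₁ C₁' U₁' S₂ C₂' U₂' E' k d')
    (hN' : IsGlued M₁ M₂ C₁' U₁' C₂' U₂' E' k N') (hinj : Set.InjOn φ E)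
    (himg : E.image φ = E') (hS₁ : ∀ x ∈ E, (φ x ∈ S₁ ∨ x ∈ S₁) → φ x = x)
    (hS₂ : ∀ x ∈ E, (φ x ∈ S₂ ∨ x ∈ S₂) → φ x = x) (hU₁ : ∀ x ∈ E, φ x ∈ U₁' ↔ x ∈ U₁)
    (hU₂ : ∀ x ∈ E, φ x ∈ U₂' ↔ x ∈ U₂) : N.Isomorphic N' := by
  have key : ∀ {M : Matroid α} {S C U C' U' : Finset α}, IsSplit M S C U E k →
      IsSplit M S C' U' E' k → (∀ x ∈ E, (φ x ∈ S ∨ x ∈ S) → φ x = x) →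
      (∀ x ∈ E, φ x ∈ U' ↔ x ∈ U) → ∀ X ⊆ E, liftRk M C' U' (X.image φ) = liftRk M C U X := by
    intro M S C U C' U' hs hs' hS hU X hX
    have h1 : M.rk (X.image φ) = M.rk X := hs.rk_congr fun x hx ↦ by
      rw [mem_image]
      constructor
      · rintro ⟨y, hy, rfl⟩
        rwa [hS y (hX hy) (.inl hx)]
      · exact fun hxX ↦ ⟨x, hxX, hS x (hX hxX) (.inr hx)⟩
    have h2 : X.image φ ∩ U' = (X ∩ U).image φ := by
      ext z
      simp only [mem_inter, mem_image]
      constructor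
      · rintro ⟨⟨x, hx, rfl⟩, hz⟩
        exact ⟨x, ⟨hx, (hU x (hX hx)).1 hz⟩, rfl⟩
      · rintro ⟨x, ⟨hx, hxU⟩, rfl⟩
        exact ⟨⟨x, hx, rfl⟩, (hU x (hX hx)).2 hxU⟩
    have h3 : #((X ∩ U).image φ) = #(X ∩ U) :=
      card_image_of_injOn (hinj.mono (by exact_mod_cast inter_subset_left.trans hX))
    have h4 := hs.card
    have h5 := hs'.card
    rw [liftRk, liftRk, h1, h2, h3]
    omega
  refine Matroid.isomorphic_of_image hN.ground hN'.ground hinj himg fun X hX ↦ ?_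
  rw [hN.rk_eq X hX, hN'.rk_eq _ (himg ▸ image_subset_image hX), glueRk, glueRk,
    key h.split₁ h'.split₁ hS₁ hU₁ X hX, key h.split₂ h'.split₂ hS₂ hU₂ X hX,
    card_image_of_injOn (hinj.mono (by exact_mod_cast hX))]

end IsGluing

lemma HasTrivialAut.apply_eq {M : Matroid α} {S : Finset α} (h : M.HasTrivialAut) (hS : M.E = S)
    (hinj : Set.InjOn φ S) (himg : S.image φ = S) (hφ : ∀ X ⊆ S, M.rk (X.image φ) = M.rk X) :
    ∀ x ∈ S, φ x = x := by
  have hb : Set.BijOn φ M.E M.E := by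
    have := hinj.bijOn_image
    rwa [← coe_image, himg, ← hS] at this
  have := h _ (isIsomorphism_of_image hb hS hφ)
  intro x hx
  have hx' : x ∈ M.E := by
    rw [hS]
    exact_mod_cast hx
  exact congrArg Subtype.val (Equiv.congr_fun this ⟨x, hx'⟩)

end Isomorphism

/-! ### From admissible data to gluings, and the count of isomorphism classes -/

section Data

variable {α : Type*} [DecidableEq α] {M₁ M₂ N N' : Matroid α}
  {S₁ S₂ P₁ P₂ T₁ T₂ P₁' P₂' T₁' T₂' : Finset α} {k : ℕ}

/-- Admissible data for the construction, as finite sets, without the inequality on `k`. -/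
structure FinData (M₁ M₂ : Matroid α) (S₁ S₂ : Finset α) (k : ℕ) (P₁ P₂ T₁ T₂ : Finset α) :
    Prop where
  subset₁ : P₁ ⊆ S₁
  subset₂ : P₂ ⊆ S₂
  card₁ : #T₁ + M₁.rk S₁ + #P₂ = k
  card₂ : #T₂ + M₂.rk S₂ + #P₁ = k
  disjoint_T : Disjoint T₁ T₂
  disjoint₁ : Disjoint T₁ (S₁ ∪ S₂)
  disjoint₂ : Disjoint T₂ (S₁ ∪ S₂)

/-- The standing assumptions on the two given matroids. -/
structure IsPair (M₁ M₂ : Matroid α) (S₁ S₂ : Finset α) (k : ℕ) : Prop where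
  noFree₁ : HasNoFree M₁ S₁
  noFree₂ : HasNoFree M₂ S₂
  disjoint : Disjoint S₁ S₂
  not_obtainable₁ : ¬ ∃ N, M₂.Obtainable N ∧ N.Isomorphic M₁
  not_obtainable₂ : ¬ ∃ N, M₁.Obtainable N ∧ N.Isomorphic M₂
  le₁ : 2 * #S₁ + #S₂ ≤ k
  le₂ : #S₁ + 2 * #S₂ ≤ k

lemma exists_finData {P₁ P₂ T₁ T₂ : Set α} (h₁ : M₁.E = S₁) (h₂ : M₂.E = S₂)
    (h : AmalgamData M₁ M₂ k P₁ P₂ T₁ T₂) : ∃ P₁' P₂' T₁' T₂' : Finset α,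
      P₁ = P₁' ∧ P₂ = P₂' ∧ T₁ = T₁' ∧ T₂ = T₂' ∧ FinData M₁ M₂ S₁ S₂ k P₁' P₂' T₁' T₂' := by
  obtain ⟨hP₁, hP₂, -, hc₁, hc₂, hT, hT₁, hT₂⟩ := h
  have hf₁ : T₁.Finite := Set.finite_of_encard_le_coe (k := k) <| by
    rw [← hc₁, add_assoc]; exact le_self_add
  have hf₂ : T₂.Finite := Set.finite_of_encard_le_coe (k := k) <| by
    rw [← hc₂, add_assoc]; exact le_self_add
  rw [h₁] at hP₁
  rw [h₂] at hP₂
  lift P₁ to Finset α using S₁.finite_toSet.subset hP₁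
  lift P₂ to Finset α using S₂.finite_toSet.subset hP₂
  lift T₁ to Finset α using hf₁
  lift T₂ to Finset α using hf₂
  rw [eRank_eq_rk h₁] at hc₁
  rw [eRank_eq_rk h₂] at hc₂
  simp only [Set.encard_coe_eq_coe_finsetCard] at hc₁ hc₂
  rw [h₁, h₂] at hT₁ hT₂
  exact ⟨P₁, P₂, T₁, T₂, rfl, rfl, rfl, rfl, by exact_mod_cast hP₁, by exact_mod_cast hP₂,
    by exact_mod_cast hc₁, by exact_mod_cast hc₂, by exact_mod_cast hT, by exact_mod_cast hT₁,
    by exact_mod_cast hT₂⟩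

/-- Two pairs of disjoint sets of equal sizes correspond under a bijection that fixes `S`. -/
lemma exists_image_union_eq {S : Finset α} (h₁ : Disjoint T₁ S) (h₂ : Disjoint T₂ S)
    (h₁₂ : Disjoint T₁ T₂) (h₁' : Disjoint T₁' S) (h₂' : Disjoint T₂' S) (h₁₂' : Disjoint T₁' T₂')
    (hc₁ : #T₁ = #T₁') (hc₂ : #T₂ = #T₂') :
    ∃ φ : α → α, Set.InjOn φ ((S ∪ T₁ ∪ T₂ : Finset α) : Set α) ∧
      (S ∪ T₁ ∪ T₂).image φ = S ∪ T₁' ∪ T₂' ∧ (∀ x ∈ S, φ x = x) ∧ (∀ x ∈ T₁, φ x ∈ T₁') ∧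
      ∀ x ∈ T₂, φ x ∈ T₂' := by
  let f₁ := equivOfCardEq hc₁
  let f₂ := equivOfCardEq hc₂
  let φ : α → α := fun x ↦ if hx : x ∈ T₁ then f₁ ⟨x, hx⟩ else if hx : x ∈ T₂ then f₂ ⟨x, hx⟩ else x
  have hφ₁ : ∀ x (hx : x ∈ T₁), φ x = f₁ ⟨x, hx⟩ := fun x hx ↦ by simp [φ, hx]
  have hφ₂ : ∀ x (hx : x ∈ T₂), φ x = f₂ ⟨x, hx⟩ := fun x hx ↦ by
    simp [φ, hx, disjoint_right.1 h₁₂ hx]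
  have hφS : ∀ x ∈ S, φ x = x := fun x hx ↦ by
    simp [φ, disjoint_right.1 h₁ hx, disjoint_right.1 h₂ hx]
  have hi₁ : T₁.image φ = T₁' := by
    ext z
    rw [mem_image]
    refine ⟨?_, fun hz ↦ ⟨f₁.symm ⟨z, hz⟩, (f₁.symm ⟨z, hz⟩).2, ?_⟩⟩
    · rintro ⟨x, hx, rfl⟩
      rw [hφ₁ x hx]
      exact (f₁ ⟨x, hx⟩).2
    · rw [hφ₁ _ (f₁.symm ⟨z, hz⟩).2, Subtype.coe_eta, Equiv.apply_symm_apply]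
  have hi₂ : T₂.image φ = T₂' := by
    ext z
    rw [mem_image]
    refine ⟨?_, fun hz ↦ ⟨f₂.symm ⟨z, hz⟩, (f₂.symm ⟨z, hz⟩).2, ?_⟩⟩
    · rintro ⟨x, hx, rfl⟩
      rw [hφ₂ x hx]
      exact (f₂ ⟨x, hx⟩).2
    · rw [hφ₂ _ (f₂.symm ⟨z, hz⟩).2, Subtype.coe_eta, Equiv.apply_symm_apply]
  have himg : (S ∪ T₁ ∪ T₂).image φ = S ∪ T₁' ∪ T₂' := by
    rw [image_union, image_union, hi₁, hi₂, image_congr (g := id) hφS, image_id]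
  refine ⟨φ, card_image_iff.1 ?_, himg, hφS, fun x hx ↦ hi₁ ▸ mem_image_of_mem φ hx,
    fun x hx ↦ hi₂ ▸ mem_image_of_mem φ hx⟩
  rw [himg, card_union_of_disjoint (disjoint_union_left.2 ⟨h₂'.symm, h₁₂'⟩),
    card_union_of_disjoint h₁'.symm, card_union_of_disjoint (disjoint_union_left.2 ⟨h₂.symm, h₁₂⟩),
    card_union_of_disjoint h₁.symm, hc₁, hc₂]

namespace FinData

variable (h : FinData M₁ M₂ S₁ S₂ k P₁ P₂ T₁ T₂)

include h

lemma disjoint_TS (x : α) : (x ∈ T₁ → x ∉ T₂ ∧ x ∉ S₁ ∧ x ∉ S₂) ∧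
    (x ∈ T₂ → x ∉ S₁ ∧ x ∉ S₂) := by
  have h1 : x ∈ T₁ → _ := fun hx ↦ disjoint_left.1 h.disjoint_T hx
  have h2 : x ∈ T₁ → _ := fun hx ↦ disjoint_left.1 h.disjoint₁ hx
  have h3 : x ∈ T₂ → _ := fun hx ↦ disjoint_left.1 h.disjoint₂ hx
  simp only [mem_union, not_or] at h2 h3
  tauto

lemma amalgamData (hp : IsPair M₁ M₂ S₁ S₂ k) : AmalgamData M₁ M₂ k P₁ P₂ T₁ T₂ where
  subset₁ := by rw [hp.noFree₁.ground]; exact_mod_cast h.subset₁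
  subset₂ := by rw [hp.noFree₂.ground]; exact_mod_cast h.subset₂
  le_k := by
    rw [eRank_eq_rk hp.noFree₁.ground, eRank_eq_rk hp.noFree₂.ground, ← coe_rk, ← coe_rk,
      Set.encard_coe_eq_coe_finsetCard, Set.encard_coe_eq_coe_finsetCard]
    have h1 := card_sdiff_add_card_eq_card h.subset₁
    have h2 := card_sdiff_add_card_eq_card h.subset₂
    -- This gives `r(Mᵢ) + ηᵢ(Pᵢ) ≤ |Sᵢ|`, so the inequality on `k` holds for all choices of
    -- subsets.
    have h3 := M₁.rk_le_rk_add_card_sdiff S₁ P₁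
    have h4 := M₂.rk_le_rk_add_card_sdiff S₂ P₂
    have h5 := hp.le₁
    exact_mod_cast (by omega)
  card₁ := by
    rw [eRank_eq_rk hp.noFree₁.ground, Set.encard_coe_eq_coe_finsetCard,
      Set.encard_coe_eq_coe_finsetCard]
    exact_mod_cast h.card₁
  card₂ := by
    rw [eRank_eq_rk hp.noFree₂.ground, Set.encard_coe_eq_coe_finsetCard,
      Set.encard_coe_eq_coe_finsetCard]
    exact_mod_cast h.card₂
  disjoint_T := by exact_mod_cast h.disjoint_T
  disjoint₁ := by
    rw [hp.noFree₁.ground, hp.noFree₂.ground]; exact_mod_cast h.disjoint₁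
  disjoint₂ := by
    rw [hp.noFree₁.ground, hp.noFree₂.ground]; exact_mod_cast h.disjoint₂

/-- Every element of `A ∩ B` is counted by `A ∩ U₁`, `B ∩ U₂`, `S₁ ∩ A` or `S₂ ∩ B`, because `T₂ ⊆
U₁` and `T₁ ⊆ U₂`. The ranks of `A` and `B` fall short of `r(M₁)` and `r(M₂)` by at most `|S₁ \ A|`
and `|S₂ \ B|`. Adding up gives the gap inequality with `d = |S₁| + |S₂|`. -/
lemma isGluing (hp : IsPair M₁ M₂ S₁ S₂ k) :
    IsGluing M₁ M₂ S₁ (T₁ ∪ P₂) (T₂ ∪ S₂ \ P₂) S₂ (T₂ ∪ P₁) (T₁ ∪ S₁ \ P₁)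
      (S₁ ∪ S₂ ∪ T₁ ∪ T₂) k (#S₁ + #S₂) := by
  have hd := h.disjoint_TS
  have hS : ∀ x ∈ S₁, x ∉ S₂ := fun x hx ↦ disjoint_left.1 hp.disjoint hx
  have hP₁ : ∀ x ∈ P₁, x ∈ S₁ := fun x hx ↦ h.subset₁ hx
  have hP₂ : ∀ x ∈ P₂, x ∈ S₂ := fun x hx ↦ h.subset₂ hx
  have hC₁ : #(T₁ ∪ P₂) = #T₁ + #P₂ := card_union_of_disjoint <| disjoint_left.2 fun x hx hx' ↦
    ((hd x).1 hx).2.2 (hP₂ x hx')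
  have hC₂ : #(T₂ ∪ P₁) = #T₂ + #P₁ := card_union_of_disjoint <| disjoint_left.2 fun x hx hx' ↦
    ((hd x).2 hx).1 (hP₁ x hx')
  have hc₁ := h.card₁
  have hc₂ := h.card₂
  have hr₁ := M₁.rk_le_card S₁
  have hr₂ := M₂.rk_le_card S₂
  have hk₁ := hp.le₁
  have hk₂ := hp.le₂
  refine ⟨⟨hp.noFree₁.ground, ?_, ?_, ?_, ?_, by omega⟩,
    ⟨hp.noFree₂.ground, ?_, ?_, ?_, ?_, by omega⟩, ?_, by omega, by omega⟩
  · ext x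
    have := hP₂ x
    simp only [mem_union, mem_sdiff]
    tauto
  · refine disjoint_left.2 fun x ↦ ?_
    have := hd x; have := hS x; have := hP₂ x
    simp only [mem_union]
    tauto
  · refine disjoint_left.2 fun x ↦ ?_
    have := hd x; have := hS x
    simp only [mem_union, mem_sdiff]
    tauto
  · refine disjoint_left.2 fun x ↦ ?_
    have := hd x; have := hP₂ x
    simp only [mem_union, mem_sdiff]
    tauto
  · ext x
    have := hP₁ x
    simp only [mem_union, mem_sdiff]
    tauto
  · refine disjoint_left.2 fun x ↦ ?_
    have := hd x; have := hS x; have := hP₁ x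
    simp only [mem_union]
    tauto
  · refine disjoint_left.2 fun x ↦ ?_
    have := hd x; have := hS x
    simp only [mem_union, mem_sdiff]
    tauto
  · refine disjoint_left.2 fun x ↦ ?_
    have := hd x; have := hP₁ x
    simp only [mem_union, mem_sdiff]
    tauto
  · intro A hA B hB
    have h1 : #(A ∩ B) ≤ #(A ∩ (T₂ ∪ S₂ \ P₂)) + #(B ∩ (T₁ ∪ S₁ \ P₁)) + #(S₁ ∩ A) + #(S₂ ∩ B) := by
      refine (card_le_card (t := A ∩ (T₂ ∪ S₂ \ P₂) ∪ B ∩ (T₁ ∪ S₁ \ P₁) ∪ S₁ ∩ A ∪ S₂ ∩ B)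
        fun x hx ↦ ?_).trans ?_
      · have hxE := hA (mem_of_mem_inter_left hx)
        simp only [mem_union, mem_inter, mem_sdiff] at hx hxE ⊢
        tauto
      · refine (card_union_le _ _).trans (Nat.add_le_add_right ?_ _)
        refine (card_union_le _ _).trans (Nat.add_le_add_right (card_union_le _ _) _)
    have h2 := M₁.rk_le_rk_add_card_sdiff S₁ A
    have h3 := M₂.rk_le_rk_add_card_sdiff S₂ B
    have h4 := card_inter_add_card_sdiff S₁ A
    have h5 := card_inter_add_card_sdiff S₂ B
    simp only [liftRk, hC₁, hC₂]
    omega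

lemma mem_cases (hp : IsPair M₁ M₂ S₁ S₂ k) : ∀ e ∈ S₁ ∪ S₂ ∪ T₁ ∪ T₂, e ∈ S₁ ∨ e ∈ S₂ ∨
    (e ∈ T₁ ∪ P₂ ∧ e ∉ T₂ ∪ P₁) ∨ (e ∈ T₂ ∪ P₁ ∧ e ∉ T₁ ∪ P₂) := by
  intro x hx
  have hd := h.disjoint_TS x
  have hS : x ∈ S₁ → x ∉ S₂ := fun hx ↦ disjoint_left.1 hp.disjoint hx
  have hP₁ : x ∈ P₁ → x ∈ S₁ := fun hx ↦ h.subset₁ hx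
  have hP₂ : x ∈ P₂ → x ∈ S₂ := fun hx ↦ h.subset₂ hx
  simp only [mem_union] at hx ⊢
  tauto

/-- The bridge from the description by cyclic flats to the explicit rank function; everything proved
about `IsGlued` passes through it. -/
lemma isFreeAmalgam_iff (hp : IsPair M₁ M₂ S₁ S₂ k) :
    IsFreeAmalgam M₁ M₂ k P₁ P₂ T₁ T₂ N ↔
      IsGlued M₁ M₂ (T₁ ∪ P₂) (T₂ ∪ S₂ \ P₂) (T₂ ∪ P₁) (T₁ ∪ S₁ \ P₁) (S₁ ∪ S₂ ∪ T₁ ∪ T₂) k N := by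
  have hg := h.isGluing hp
  have hE : M₁.E ∪ M₂.E ∪ T₁ ∪ T₂ = ((S₁ ∪ S₂ ∪ T₁ ∪ T₂ : Finset α) : Set α) := by
    rw [hp.noFree₁.ground, hp.noFree₂.ground]
    push_cast
    rfl
  have hnp : ∀ {M : Matroid α} {S F : Finset α}, M.E = S →
      (M.IsNonemptyProperCyclicFlat F ↔ M.IsCyclicFlat (F : Set α) ∧ F.Nonempty ∧ F ≠ S) := by
    intro M S F hS
    rw [IsNonemptyProperCyclicFlat, hS, coe_nonempty, ne_eq, coe_inj]
  have hdisj : ∀ {T P : Finset α}, Disjoint T P →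
      (T : Set α).encard + (P : Set α).encard = (#(T ∪ P) : ℕ∞) := by
    intro T P hTP
    rw [card_union_of_disjoint hTP, Set.encard_coe_eq_coe_finsetCard,
      Set.encard_coe_eq_coe_finsetCard, Nat.cast_add]
  have hd₁ := hdisj (h.disjoint₁.mono_right (h.subset₂.trans subset_union_right))
  have hd₂ := hdisj (h.disjoint₂.mono_right (h.subset₁.trans subset_union_left))
  have hrk : ∀ {M : Matroid α} {F T P : Finset α},
      (T : Set α).encard + (P : Set α).encard = (#(T ∪ P) : ℕ∞) →
      (N.eRk (F ∪ T ∪ P) = M.eRk F + (T : Set α).encard + (P : Set α).encard ↔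
        N.rk (F ∪ (T ∪ P)) = M.rk F + #(T ∪ P)) := by
    intro M F T P hTP
    rw [add_assoc, hTP, ← Nat.cast_inj (R := ℕ∞), Nat.cast_add, coe_rk, coe_rk, coe_union,
      coe_union, Set.union_assoc]
  have hflat : ∀ {M : Matroid α} {S T P Z : Finset α}, M.E = S →
      ((∃ F, M.IsNonemptyProperCyclicFlat F ∧ (Z : Set α) = F ∪ T ∪ P) ↔
        ∃ F ⊆ S, M.IsCyclicFlat (F : Set α) ∧ F.Nonempty ∧ F ≠ S ∧ Z = F ∪ (T ∪ P)) := by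
    intro M S T P Z hS
    constructor
    · rintro ⟨F, hF, hZ⟩
      obtain ⟨F, hFS, rfl⟩ := hF.1.exists_finset hS
      rw [hnp hS] at hF
      refine ⟨F, hFS, hF.1, hF.2.1, hF.2.2, ?_⟩
      rw [← coe_inj, hZ, coe_union, coe_union, Set.union_assoc]
    · rintro ⟨F, hFS, hF, hne, hp, rfl⟩
      exact ⟨F, (hnp hS).2 ⟨hF, hne, hp⟩, by rw [coe_union, coe_union, Set.union_assoc]⟩
  constructor
  · intro hN
    have hNE := hN.ground.trans hE
    refine hg.isGlued_of_isCyclicFlat_iff hNE ?_ ?_ ?_ fun Z hZE hZ ↦ ?_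
    · rw [rk_eq_iff, ← hE, hN.rank_ground]
    · exact fun F _ hFc hne hpr ↦
        (hrk hd₁).1 (hN.rank₁ F ((hnp hp.noFree₁.ground).2 ⟨hFc, hne, hpr⟩))
    · exact fun F _ hFc hne hpr ↦
        (hrk hd₂).1 (hN.rank₂ F ((hnp hp.noFree₂.ground).2 ⟨hFc, hne, hpr⟩))
    · rw [hN.cyclicFlat_iff, hflat hp.noFree₁.ground, hflat hp.noFree₂.ground, hE, coe_inj,
        coe_eq_empty] at hZ
      exact hZ
  · intro hN
    have hiff := fun Z hZ ↦ hg.isCyclicFlat_iff hN hp.noFree₁.pos hp.noFree₂.pos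
      hp.noFree₁.rk_le_rk_erase_ground hp.noFree₂.rk_le_rk_erase_ground hp.noFree₁.rk_lt_card
      (Z := Z) hZ
    refine ⟨hN.ground.trans hE.symm, fun Z ↦ ?_, fun F hF ↦ ?_, fun F hF ↦ ?_, eRk_empty _, ?_⟩
    · by_cases hZ : Z ⊆ ((S₁ ∪ S₂ ∪ T₁ ∪ T₂ : Finset α) : Set α)
      · lift Z to Finset α using (S₁ ∪ S₂ ∪ T₁ ∪ T₂).finite_toSet.subset hZ
        rw [hflat hp.noFree₁.ground, hflat hp.noFree₂.ground, hE, coe_inj, coe_eq_empty]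
        exact hiff Z (by exact_mod_cast hZ)
      · refine iff_of_false (fun h' ↦ hZ (hN.ground ▸ h'.1.subset_ground)) fun h' ↦ hZ ?_
        have hsub₁ := h.subset₁
        have hsub₂ := h.subset₂
        rw [← coe_subset, ← hp.noFree₁.ground] at hsub₁
        rw [← coe_subset, ← hp.noFree₂.ground] at hsub₂
        rw [← hE]
        obtain ⟨F, hF, rfl⟩ | ⟨F, hF, rfl⟩ | rfl | rfl := h'
        · have := hF.1.1.subset_ground
          intro x
          have := @this x; have := @hsub₂ x
          simp only [Set.mem_union]
          tauto
        · have := hF.1.1.subset_ground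
          intro x
          have := @this x; have := @hsub₁ x
          simp only [Set.mem_union]
          tauto
        · exact Set.empty_subset _
        · exact subset_rfl
    · obtain ⟨F, hFS, rfl⟩ := hF.1.exists_finset hp.noFree₁.ground
      exact (hrk hd₁).2 (hg.rk_union_C hN hFS)
    · obtain ⟨F, hFS, rfl⟩ := hF.1.exists_finset hp.noFree₂.ground
      exact (hrk hd₂).2 (hg.symm.rk_union_C hN.symm hFS)
    · rw [hE, ← rk_eq_iff, hg.rk_ground hN]

lemma existsUnique (hp : IsPair M₁ M₂ S₁ S₂ k) : ∃! N, IsFreeAmalgam M₁ M₂ k P₁ P₂ T₁ T₂ N := by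
  obtain ⟨N, hN⟩ := (h.isGluing hp).exists_isGlued
  refine ⟨N, (h.isFreeAmalgam_iff hp).2 hN, fun N' hN' ↦ ?_⟩
  have hN' := (h.isFreeAmalgam_iff hp).1 hN'
  exact ext_rk hN'.ground hN.ground fun A hA ↦ by rw [hN.rk_eq A hA, hN'.rk_eq A hA]

/-- Isomorphic constructed matroids come from subsets of the ground sets that correspond under
automorphisms of `M₁` and `M₂`. -/
lemma exists_image_of_isomorphic (hp : IsPair M₁ M₂ S₁ S₂ k)
    (h' : FinData M₁ M₂ S₁ S₂ k P₁' P₂' T₁' T₂') (hN : IsFreeAmalgam M₁ M₂ k P₁ P₂ T₁ T₂ N)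
    (hN' : IsFreeAmalgam M₁ M₂ k P₁' P₂' T₁' T₂' N') (hiso : N.Isomorphic N') :
    ∃ φ : α → α, Set.InjOn φ S₁ ∧ Set.InjOn φ S₂ ∧ S₁.image φ = S₁ ∧ S₂.image φ = S₂ ∧
      (∀ X ⊆ S₁, M₁.rk (X.image φ) = M₁.rk X) ∧ (∀ X ⊆ S₂, M₂.rk (X.image φ) = M₂.rk X) ∧
      P₁.image φ = P₁' ∧ P₂.image φ = P₂' := by
  rw [h.isFreeAmalgam_iff hp] at hN
  rw [h'.isFreeAmalgam_iff hp] at hN'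
  have hg := h.isGluing hp
  have hg' := h'.isGluing hp
  obtain ⟨φ, hinj, himg, hφ⟩ := hiso.exists_image hN.ground hN'.ground
  obtain ⟨hS₁, hC₁, ha₁⟩ := hg.image_eq_of_isomorphic hN hg' hN' hp.noFree₁ hp.not_obtainable₁
    hinj himg hφ
  obtain ⟨hS₂, hC₂, ha₂⟩ := hg.symm.image_eq_of_isomorphic hN.symm hg'.symm hN'.symm hp.noFree₂
    hp.not_obtainable₂ hinj himg hφ
  -- The chosen subsets are recovered as `S₁ ∩ C₂` and `S₂ ∩ C₁`, which isomorphisms respect.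
  have hi₁ : ∀ {P₁ P₂ T₁ T₂ : Finset α}, FinData M₁ M₂ S₁ S₂ k P₁ P₂ T₁ T₂ →
      S₁ ∩ (T₂ ∪ P₁) = P₁ := by
    intro P₁ P₂ T₁ T₂ h
    ext x
    have := h.disjoint_TS x
    have : x ∈ P₁ → x ∈ S₁ := fun hx ↦ h.subset₁ hx
    simp only [mem_inter, mem_union]
    tauto
  have hi₂ : ∀ {P₁ P₂ T₁ T₂ : Finset α}, FinData M₁ M₂ S₁ S₂ k P₁ P₂ T₁ T₂ →
      S₂ ∩ (T₁ ∪ P₂) = P₂ := by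
    intro P₁ P₂ T₁ T₂ h
    ext x
    have := h.disjoint_TS x
    have : x ∈ P₂ → x ∈ S₂ := fun hx ↦ h.subset₂ hx
    simp only [mem_inter, mem_union]
    tauto
  have hint : ∀ {X Y : Finset α}, X ⊆ S₁ ∪ S₂ ∪ T₁ ∪ T₂ → Y ⊆ S₁ ∪ S₂ ∪ T₁ ∪ T₂ →
      (X ∩ Y).image φ = X.image φ ∩ Y.image φ := by
    intro X Y hX hY
    refine image_inter_of_injOn _ _ (hinj.mono ?_)
    rw [← coe_union, coe_subset]
    exact union_subset hX hY
  refine ⟨φ, hinj.mono (coe_subset.2 hg.split₁.subset), hinj.mono (coe_subset.2 hg.split₂.subset),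
    hS₁, hS₂, ha₁, ha₂, ?_, ?_⟩
  · rw [← hi₁ h, hint hg.split₁.subset hg.split₂.subset_C, hS₁, hC₂, hi₁ h']
  · rw [← hi₂ h, hint hg.split₂.subset hg.split₁.subset_C, hS₂, hC₁, hi₂ h']

/-- Up to isomorphism, the choice of `T₁` and `T₂` does not matter. -/
lemma isomorphic (hp : IsPair M₁ M₂ S₁ S₂ k) (h' : FinData M₁ M₂ S₁ S₂ k P₁ P₂ T₁' T₂')
    (hN : IsFreeAmalgam M₁ M₂ k P₁ P₂ T₁ T₂ N) (hN' : IsFreeAmalgam M₁ M₂ k P₁ P₂ T₁' T₂' N') :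
    N.Isomorphic N' := by
  rw [h.isFreeAmalgam_iff hp] at hN
  rw [h'.isFreeAmalgam_iff hp] at hN'
  have hc₁ : #T₁ = #T₁' := by
    have := h.card₁; have := h'.card₁
    omega
  have hc₂ : #T₂ = #T₂' := by
    have := h.card₂; have := h'.card₂
    omega
  obtain ⟨φ, hinj, himg, hφS, hφ₁, hφ₂⟩ := exists_image_union_eq h.disjoint₁ h.disjoint₂
    h.disjoint_T h'.disjoint₁ h'.disjoint₂ h'.disjoint_T hc₁ hc₂
  have hcase : ∀ x ∈ S₁ ∪ S₂ ∪ T₁ ∪ T₂,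
      (x ∈ T₁ ∧ x ∉ T₂ ∧ x ∉ S₁ ∧ x ∉ S₂ ∧ φ x ∈ T₁' ∧ φ x ∉ T₂' ∧ φ x ∉ S₁ ∧ φ x ∉ S₂) ∨
      (x ∉ T₁ ∧ x ∈ T₂ ∧ x ∉ S₁ ∧ x ∉ S₂ ∧ φ x ∉ T₁' ∧ φ x ∈ T₂' ∧ φ x ∉ S₁ ∧ φ x ∉ S₂) ∨
      (φ x = x ∧ x ∉ T₁ ∧ x ∉ T₂ ∧ x ∉ T₁' ∧ x ∉ T₂') := by
    intro x hx
    rw [mem_union, mem_union] at hx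
    obtain (hx | hx) | hx := hx
    · exact .inr (.inr ⟨hφS x hx, disjoint_right.1 h.disjoint₁ hx, disjoint_right.1 h.disjoint₂ hx,
        disjoint_right.1 h'.disjoint₁ hx, disjoint_right.1 h'.disjoint₂ hx⟩)
    · have h1 := (h.disjoint_TS x).1 hx
      have h2 := (h'.disjoint_TS (φ x)).1 (hφ₁ x hx)
      exact .inl ⟨hx, h1.1, h1.2.1, h1.2.2, hφ₁ x hx, h2⟩
    · have h1 := (h.disjoint_TS x).2 hx
      have h2 := (h'.disjoint_TS (φ x)).2 (hφ₂ x hx)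
      exact .inr (.inl ⟨disjoint_right.1 h.disjoint_T hx, hx, h1.1, h1.2,
        disjoint_right.1 h'.disjoint_T (hφ₂ x hx), hφ₂ x hx, h2⟩)
  refine (h.isGluing hp).isomorphic_of_image hN (h'.isGluing hp) hN' hinj himg ?_ ?_ ?_ ?_ <;>
  · intro x hx
    obtain ⟨h1, h2, h3, h4, h5, h6, h7, h8⟩ | ⟨h1, h2, h3, h4, h5, h6, h7, h8⟩ |
      ⟨h1, h2, h3, h4, h5⟩ := hcase x hx
    all_goals simp [*]

end FinData

lemma exists_disjoint_card_eq [Infinite α] (S : Finset α) (n : ℕ) :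
    ∃ T : Finset α, Disjoint T S ∧ #T = n := by
  obtain ⟨T, hT, hc⟩ := Infinite.exists_superset_card_eq S (#S + n) (by omega)
  refine ⟨T \ S, sdiff_disjoint, ?_⟩
  have := card_sdiff_add_card_eq_card hT
  omega

namespace IsPair

variable [Infinite α] (hp : IsPair M₁ M₂ S₁ S₂ k)

include hp

lemma exists_finData (hP₁ : P₁ ⊆ S₁) (hP₂ : P₂ ⊆ S₂) :
    ∃ T₁ T₂, FinData M₁ M₂ S₁ S₂ k P₁ P₂ T₁ T₂ := by
  have h1 := card_le_card hP₁
  have h2 := card_le_card hP₂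
  have h3 := M₁.rk_le_card S₁
  have h4 := M₂.rk_le_card S₂
  have h5 := hp.le₁
  have h6 := hp.le₂
  obtain ⟨T₁, hT₁, hc₁⟩ := exists_disjoint_card_eq (S₁ ∪ S₂) (k - M₁.rk S₁ - #P₂)
  obtain ⟨T₂, hT₂, hc₂⟩ := exists_disjoint_card_eq (T₁ ∪ (S₁ ∪ S₂)) (k - M₂.rk S₂ - #P₁)
  rw [disjoint_union_right] at hT₂
  exact ⟨T₁, T₂, hP₁, hP₂, by omega, by omega, hT₂.1.symm, hT₁, hT₂.2⟩

/-- Choose one constructed matroid for each pair of subsets of the ground sets. -/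
lemma exists_representatives : ∃ K : Finset α × Finset α → Matroid α,
    ∀ P ∈ S₁.powerset ×ˢ S₂.powerset, ∃ T₁ T₂, FinData M₁ M₂ S₁ S₂ k P.1 P.2 T₁ T₂ ∧
      IsFreeAmalgam M₁ M₂ k P.1 P.2 T₁ T₂ (K P) := by
  have : ∀ P : Finset α × Finset α, ∃ N : Matroid α, P ∈ S₁.powerset ×ˢ S₂.powerset →
      ∃ T₁ T₂, FinData M₁ M₂ S₁ S₂ k P.1 P.2 T₁ T₂ ∧
      IsFreeAmalgam M₁ M₂ k P.1 P.2 T₁ T₂ N := by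
    intro P
    by_cases hP : P ∈ S₁.powerset ×ˢ S₂.powerset
    · rw [mem_product, mem_powerset, mem_powerset] at hP
      obtain ⟨T₁, T₂, hT⟩ := hp.exists_finData hP.1 hP.2
      obtain ⟨N, hN, -⟩ := hT.existsUnique hp
      exact ⟨N, fun _ ↦ ⟨T₁, T₂, hT, hN⟩⟩
    · exact ⟨M₁, fun h ↦ absurd h hP⟩
  choose K hK using this
  exact ⟨K, hK⟩

/-- Isomorphic constructed matroids have chosen subsets of equal sizes, so one subset of each size
in `S₁` and in `S₂` already yields this many classes. -/
theorem le_encard_isoClasses :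
    (((#S₁ + 1) * (#S₂ + 1) : ℕ) : ℕ∞) ≤ (isoClasses (constructed M₁ M₂ k)).encard := by
  obtain ⟨K, hK⟩ := hp.exists_representatives
  have hchain : ∀ S : Finset α, ∃ p : ℕ → Finset α, ∀ i ∈ range (#S + 1), p i ⊆ S ∧ #(p i) = i := by
    intro S
    have : ∀ i, ∃ P : Finset α, i ∈ range (#S + 1) → P ⊆ S ∧ #P = i := by
      intro i
      by_cases hi : i ∈ range (#S + 1)
      · obtain ⟨P, hP⟩ := exists_subset_card_eq (Nat.lt_succ_iff.1 (mem_range.1 hi))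
        exact ⟨P, fun _ ↦ hP⟩
      · exact ⟨∅, fun h ↦ absurd h hi⟩
    choose p h using this
    exact ⟨p, h⟩
  obtain ⟨p, hpS⟩ := hchain S₁
  obtain ⟨q, hqS⟩ := hchain S₂
  have hmem : ∀ x ∈ range (#S₁ + 1) ×ˢ range (#S₂ + 1), (p x.1, q x.2) ∈
      S₁.powerset ×ˢ S₂.powerset := by
    intro x hx
    rw [mem_product] at hx
    rw [mem_product, mem_powerset, mem_powerset]
    exact ⟨(hpS _ hx.1).1, (hqS _ hx.2).1⟩
  have hcard : ((range (#S₁ + 1) ×ˢ range (#S₂ + 1) : Finset (ℕ × ℕ)) : Set (ℕ × ℕ)).encard =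
      (((#S₁ + 1) * (#S₂ + 1) : ℕ) : ℕ∞) := by
    rw [Set.encard_coe_eq_coe_finsetCard, card_product, card_range, card_range]
  rw [← hcard]
  refine Set.encard_le_encard_of_injOn
    (f := fun x ↦ Quotient.mk (isoSetoid α) (K (p x.1, q x.2))) (fun x hx ↦ ?_) ?_
  · obtain ⟨T₁, T₂, hT, hN⟩ := hK _ (hmem x hx)
    exact ⟨_, ⟨_, _, _, _, hT.amalgamData hp, hN⟩, rfl⟩
  · intro x hx y hy hxy
    have hiso : (K (p x.1, q x.2)).Isomorphic (K (p y.1, q y.2)) := Quotient.exact hxy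
    obtain ⟨T₁, T₂, hT, hN⟩ := hK _ (hmem x hx)
    obtain ⟨T₁', T₂', hT', hN'⟩ := hK _ (hmem y hy)
    obtain ⟨φ, hi₁, hi₂, -, -, -, -, hP₁, hP₂⟩ := hT.exists_image_of_isomorphic hp hT' hN hN' hiso
    rw [mem_coe, mem_product] at hx hy
    have h1 := card_image_of_injOn (hi₁.mono (coe_subset.2 hT.subset₁))
    have h2 := card_image_of_injOn (hi₂.mono (coe_subset.2 hT.subset₂))
    rw [hP₁] at h1
    rw [hP₂] at h2
    dsimp only at h1 h2
    rw [(hpS _ hx.1).2, (hpS _ hy.1).2] at h1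
    rw [(hqS _ hx.2).2, (hqS _ hy.2).2] at h2
    exact Prod.ext h1.symm h2.symm

/-- An isomorphism now fixes `S₁` and `S₂` pointwise, so distinct pairs of subsets give distinct
classes; the choice of `T₁` and `T₂` adds no further classes. -/
theorem encard_isoClasses (h₁ : M₁.HasTrivialAut) (h₂ : M₂.HasTrivialAut) :
    (isoClasses (constructed M₁ M₂ k)).encard = ((2 ^ (#S₁ + #S₂) : ℕ) : ℕ∞) := by
  obtain ⟨K, hK⟩ := hp.exists_representatives
  have himg : isoClasses (constructed M₁ M₂ k) = (fun P ↦ Quotient.mk (isoSetoid α) (K P)) ''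
      ((S₁.powerset ×ˢ S₂.powerset : Finset (Finset α × Finset α)) :
        Set (Finset α × Finset α)) := by
    refine Set.Subset.antisymm ?_ ?_
    · rintro _ ⟨N, ⟨P₁, P₂, T₁, T₂, hD, hN⟩, rfl⟩
      obtain ⟨P₁, P₂, T₁, T₂, rfl, rfl, rfl, rfl, hT⟩ :=
        Matroid.exists_finData hp.noFree₁.ground hp.noFree₂.ground hD
      have hP : (P₁, P₂) ∈ S₁.powerset ×ˢ S₂.powerset := by
        rw [mem_product, mem_powerset, mem_powerset]
        exact ⟨hT.subset₁, hT.subset₂⟩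
      obtain ⟨T₁', T₂', hT', hN'⟩ := hK _ hP
      exact ⟨(P₁, P₂), hP, Quotient.sound (hT'.isomorphic hp hT hN' hN)⟩
    · rintro _ ⟨P, hP, rfl⟩
      obtain ⟨T₁, T₂, hT, hN⟩ := hK P hP
      exact ⟨_, ⟨_, _, _, _, hT.amalgamData hp, hN⟩, rfl⟩
  rw [himg, Set.InjOn.encard_image, Set.encard_coe_eq_coe_finsetCard, card_product, card_powerset,
    card_powerset, pow_add]
  intro P hP P' hP' heq
  have hiso : (K P).Isomorphic (K P') := Quotient.exact heq
  obtain ⟨T₁, T₂, hT, hN⟩ := hK P hP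
  obtain ⟨T₁', T₂', hT', hN'⟩ := hK P' hP'
  obtain ⟨φ, hi₁, hi₂, hS₁, hS₂, ha₁, ha₂, hP₁, hP₂⟩ :=
    hT.exists_image_of_isomorphic hp hT' hN hN' hiso
  have hid₁ := h₁.apply_eq hp.noFree₁.ground hi₁ hS₁ ha₁
  have hid₂ := h₂.apply_eq hp.noFree₂.ground hi₂ hS₂ ha₂
  refine Prod.ext ?_ ?_
  · rw [← hP₁, image_congr (g := id) fun x hx ↦ hid₁ x (hT.subset₁ hx), image_id]
  · rw [← hP₂, image_congr (g := id) fun x hx ↦ hid₂ x (hT.subset₂ hx), image_id]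

end IsPair

end Data

end Matroid

/-! ### The corollary -/

theorem mainTheorem5 {α : Type*} [Infinite α] (M₁ M₂ : Matroid α) [M₁.Finite] [M₂.Finite]
    (hdisj : Disjoint M₁.E M₂.E)
    (hr₁ : 0 < M₁.eRank) (hr₂ : 0 < M₂.eRank)
    (h₁ : ¬ ∃ N, M₂.Obtainable N ∧ N.Isomorphic M₁)
    (h₂ : ¬ ∃ N, M₁.Obtainable N ∧ N.Isomorphic M₂)
    (hFI₁ : M₁.freeOrIsthmus = ∅) (hFI₁' : M₁✶.freeOrIsthmus = ∅)
    (hFI₂ : M₂.freeOrIsthmus = ∅) (hFI₂' : M₂✶.freeOrIsthmus = ∅)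
    (k : ℕ) (hk : 4 * max M₁.E.ncard M₂.E.ncard ≤ k) :
    (∀ S₁' S₂' T₁ T₂ : Set α, Matroid.AmalgamData M₁ M₂ k S₁' S₂' T₁ T₂ →
      ∃! M : Matroid α, Matroid.IsFreeAmalgam M₁ M₂ k S₁' S₂' T₁ T₂ M) ∧
    (∀ M ∈ Matroid.constructed M₁ M₂ k, M.IsIntertwine M₁ M₂ ∧ M.eRank = k) ∧
    (((M₁.E.ncard + 1) * (M₂.E.ncard + 1) : ℕ) : ℕ∞) ≤
      (Matroid.isoClasses (Matroid.constructed M₁ M₂ k)).encard ∧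
    (M₁.HasTrivialAut → M₂.HasTrivialAut →
      (Matroid.isoClasses (Matroid.constructed M₁ M₂ k)).encard =
        ((2 ^ (M₁.E.ncard + M₂.E.ncard) : ℕ) : ℕ∞)) := by
  classical
  obtain ⟨S₁, hS₁⟩ := M₁.ground_finite.exists_finset_coe
  obtain ⟨S₂, hS₂⟩ := M₂.ground_finite.exists_finset_coe
  rw [← hS₁, ← hS₂, Finset.disjoint_coe] at hdisj
  have hc₁ : M₁.E.ncard = S₁.card := by rw [← hS₁, Set.ncard_coe_finset]
  have hc₂ : M₂.E.ncard = S₂.card := by rw [← hS₂, Set.ncard_coe_finset]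
  rw [hc₁, hc₂] at hk ⊢
  have hp : Matroid.IsPair M₁ M₂ S₁ S₂ k :=
    ⟨Matroid.hasNoFree_of_freeOrIsthmus_eq_empty hS₁.symm hr₁ hFI₁ hFI₁',
      Matroid.hasNoFree_of_freeOrIsthmus_eq_empty hS₂.symm hr₂ hFI₂ hFI₂', hdisj, h₁, h₂,
      by omega, by omega⟩
  refine ⟨fun P₁ P₂ T₁ T₂ hD ↦ ?_, ?_, hp.le_encard_isoClasses, hp.encard_isoClasses⟩
  · obtain ⟨P₁, P₂, T₁, T₂, rfl, rfl, rfl, rfl, hT⟩ :=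
      Matroid.exists_finData hS₁.symm hS₂.symm hD
    exact hT.existsUnique hp
  · rintro N ⟨P₁, P₂, T₁, T₂, hD, hN⟩
    obtain ⟨P₁, P₂, T₁, T₂, rfl, rfl, rfl, rfl, hT⟩ :=
      Matroid.exists_finData hS₁.symm hS₂.symm hD
    rw [hT.isFreeAmalgam_iff hp] at hN
    have hg := hT.isGluing hp
    exact ⟨hg.isIntertwine hN hp.noFree₁ hp.noFree₂ h₁ h₂ (hT.mem_cases hp),
      by rw [Matroid.eRank_eq_rk hN.ground, hg.rk_ground hN]⟩
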